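/- **Model.** Let $U$ be a densely ordered totally ordered set with at least two elements. A deterministic comparison-based summary $D$ processes a stream of items of $U$ one by one; its memory is a pair $(I,G)$ of an item array $I$, initially empty, and a general memory $G$ (of unrestricted size) that holds no items. When an item $a$ arrives, the computation is determined solely by $|I|$, the content of $G$ and the results (smaller, equal, larger) of comparing $a$ with each $I[j]$; every entry of the new array is either $a$ or an entry of the old array. A query $\varphi\in[0,1]$ is answered by an entry $I[j]$, where $j$ depends only on $\varphi$, $|I|$ and the content of $G$. The number of items that $D$ stores on a stream is the maximum of $|I|$ during the processing of that stream. Finally, $D$ is an $\varepsilon$-approximate biased quantile summary if after every stream of every length $N$ and for every $\varphi\in[0,1]$ with $\lfloor\varphi N\rfloor\ge 1$, the answer is a $k$-th smallest item of the stream for some $k$ with $|k-\lfloor\varphi N\rfloor|\le\varepsilon\varphi N$. **Theorem.** There is an absolute constant $c>0$ such that for every such $U$, every $0<\varepsilon<1/16$, every deterministic comparison-based $\varepsilon$-approximate biased quantile summary $D$ for streams over $U$ and every integer $N\ge 1/\varepsilon$, there is a stream of length $N$ on which $D$ stores at least $$c\cdot\frac1\varepsilon\cdot\log^2(\varepsilon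 N)$$ items. In particular, no such summary stores $o\!\left(\frac1\varepsilon\log^2(\varepsilon N)\right)$ items on every stream of length $N$. -/

import Mathlib

/-- A deterministic comparison-based quantile summary whose general memory has contents in `G`.
The item array `I` is handled only through its length and through indices, so that the summary
is oblivious of the universe of items:
* `init` is the initial content of the general memory (the item array is initially empty);
* when an item `a` arrives while `n` items are stored, `update n c g` is determined by the results
  `c j` of comparing `a` with `I[j]`, by `n`, and by the content `g` of the general memory.
  It yields the new content of the general memory and a list that says what the new item array
  consists of: `none` stands for the arriving item `a`, and `some j` for the old entry `I[j]`;
* given a query `φ`, `answer n g φ` is the index of the entry of the item array to be returned. -/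
structure ComparisonSummary (G : Type*) where
  init : G
  update : (n : ℕ) → (Fin n → Ordering) → G → List (Option (Fin n)) × G
  answer : ℕ → G → ℝ → ℕ

namespace ComparisonSummary

variable {G : Type*} {U : Type*} [LinearOrder U]

/-- One step on the memory state `(I, g)`: the item `a` arrives. -/
def step (D : ComparisonSummary G) (M : List U × G) (a : U) : List U × G :=
  let r := D.update M.1.length (fun j => cmp a (M.1.get j)) M.2
  (r.1.map (fun o => o.elim a M.1.get), r.2)

/-- The memory state `(I, g)` after processing the stream `σ` from the empty memory state. -/
def run (D : ComparisonSummary G) (σ : List U) : List U × G :=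
  σ.foldl D.step ([], D.init)

/-- The item returned for the query `φ` after processing `σ` (`none` if there is no such entry
in the item array). -/
def query (D : ComparisonSummary G) (σ : List U) (φ : ℝ) : Option U :=
  (D.run σ).1[D.answer (D.run σ).1.length (D.run σ).2 φ]?

/-- The number of items that `D` stores on the stream `σ`: the maximum size of the item array
during the computation. -/
def itemsStored (D : ComparisonSummary G) (σ : List U) : ℕ :=
  (Finset.range (σ.length + 1)).sup (fun t => (D.run (σ.take t)).1.length)

end ComparisonSummary

/-- `x` is the `k`-th smallest item of the stream `σ` (`k` counts from `1`; equal items occupy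
consecutive positions). -/
def IsKthSmallest {U : Type*} [LinearOrder U] (σ : List U) (k : ℕ) (x : U) : Prop :=
  σ.countP (fun y => decide (y < x)) < k ∧ k ≤ σ.countP (fun y => decide (y ≤ x))

/-- `D` is an `ε`-approximate biased quantile summary for streams of items from `U`: after any
stream of length `N`, a query for the `φ`-quantile, i.e., for the `⌊φ N⌋`-th smallest item, is
answered by a `k`-th smallest item of the stream with `|k - ⌊φ N⌋| ≤ ε φ N`. -/
def IsBiasedQuantileSummary (U : Type*) [LinearOrder U] {G : Type*}
    (D : ComparisonSummary G) (ε : ℝ) : Prop :=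
  ∀ (σ : List U) (φ : ℝ), 0 ≤ φ → φ ≤ 1 → 1 ≤ ⌊φ * (σ.length : ℝ)⌋₊ →
    ∃ x : U, D.query σ φ = some x ∧
      ∃ k : ℕ, IsKthSmallest σ k x ∧
        |(k : ℝ) - (⌊φ * (σ.length : ℝ)⌋₊ : ℝ)| ≤ ε * φ * (σ.length : ℝ)

/-!
The items may be taken from `ℚ`, which embeds into the universe. The adversary builds two streams at
once, as a list of pairs of items. As long as every arriving pair compares, in both coordinates, in
the same way with all stored pairs (`Consistent`), the summary does the same on both streams, and
each query is answered by the two coordinates of the same stored pair. If thresholds `α`, `β` in the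
two streams are not separated by a stored pair (`IsCut`), but many more items of the second stream
lie below `β` than items of the first stream lie below `α`, then a query for a rank in between
fails: the `excess` at a cut is at most about `2 * ε` times the rank
(`excess_le_of_isBiasedQuantileSummary`).

The adversary works in about `log (ε * N)` regions of the universe. Each region has four times as
many items as the next lower one, hence an excess of at most `3 * ε` times the number of its items.
Within a region, the items arrive in two halves, recursively: after the first half, the second half
is inserted right before the two thresholds of a cut, which nothing that is stored can tell apart.
Then the excesses of the two halves add up. Moreover, while the second half arrives, stored pairs
of the first half must leave no gaps larger than the final excess `h`, so that at least
`n / (h + 1) - 2` of its `n` items are stored (`card_firsts_le`). Since on each level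
of the recursion the excesses add up to at most `3 * ε` times the number of items of the region, a
convexity argument shows that each level contributes an average, over time, of `Ω(1 / ε)` stored
items.

The summary could compress a region while the adversary works on another one. For this reason all
regions are played simultaneously: a round for the regions `s < R` is doubled as a whole
(`Forces.double`), and the next lower region is added only with its first items
(`Forces.add_region`). Then the time averages of all regions add up, and at some moment their sum is
attained: about `1 / ε` for every region and every level of its recursion, which is
`Ω(1 / ε * log (ε * N) ^ 2)` in total. The averages are not written as such: in each doubling, the
better one of two moments is chosen, and convexity is used through a tangent line
(`guarantee_double`), which makes the guarantee linear in the excess.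

For `ε * N` below a constant, it suffices that the lowest `1 / ε - 1` items have to be stored
(`le_itemsStored_of_lowest`).
-/

/-! ### Boxes, excess, cuts and memories -/

namespace PairedStream

/-- A pair of nonempty open intervals of `ℚ`. -/
structure Box where
  l₁ : ℚ
  u₁ : ℚ
  l₂ : ℚ
  u₂ : ℚ
  lt₁ : l₁ < u₁
  lt₂ : l₂ < u₂

namespace Box

/-- Both coordinates of `x` lie in the respective open interval. -/
def Inside (B : Box) (x : ℚ × ℚ) : Prop :=
  (B.l₁ < x.1 ∧ x.1 < B.u₁) ∧ (B.l₂ < x.2 ∧ x.2 < B.u₂)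

instance (B : Box) : DecidablePred B.Inside := fun x => by unfold Inside; infer_instance

/-- Neither coordinate of `x` lies in the respective open interval. -/
def Avoids (B : Box) (x : ℚ × ℚ) : Prop :=
  (x.1 ≤ B.l₁ ∨ B.u₁ ≤ x.1) ∧ (x.2 ≤ B.l₂ ∨ B.u₂ ≤ x.2)

/-- The coordinates of `x` lie on the same side of the respective open interval. -/
def Aligned (B : Box) (x : ℚ × ℚ) : Prop :=
  (x.1 ≤ B.l₁ ∧ x.2 ≤ B.l₂) ∨ (B.u₁ ≤ x.1 ∧ B.u₂ ≤ x.2)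

/-- `B` lies below `C` in both coordinates. -/
def Below (B C : Box) : Prop := B.u₁ ≤ C.l₁ ∧ B.u₂ ≤ C.l₂

/-- `B` is contained in `C`. -/
def Sub (B C : Box) : Prop := (C.l₁ ≤ B.l₁ ∧ B.u₁ ≤ C.u₁) ∧ (C.l₂ ≤ B.l₂ ∧ B.u₂ ≤ C.u₂)

theorem Sub.refl (B : Box) : B.Sub B := ⟨⟨le_rfl, le_rfl⟩, le_rfl, le_rfl⟩

theorem Sub.inside {B C : Box} (h : B.Sub C) {x : ℚ × ℚ} (hx : B.Inside x) : C.Inside x :=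
  ⟨⟨h.1.1.trans_lt hx.1.1, hx.1.2.trans_le h.1.2⟩, ⟨h.2.1.trans_lt hx.2.1, hx.2.2.trans_le h.2.2⟩⟩

theorem Sub.below {B B' C C' : Box} (hB : B'.Sub B) (hC : C'.Sub C) (h : B.Below C) :
    B'.Below C' :=
  ⟨hB.1.2.trans (h.1.trans hC.1.1), hB.2.2.trans (h.2.trans hC.2.1)⟩

theorem Avoids.not_inside {B : Box} {x : ℚ × ℚ} (h : B.Avoids x) : ¬ B.Inside x := by
  rintro ⟨⟨h1, h2⟩, -⟩
  rcases h.1 with h | h <;> linarith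

theorem Aligned.avoids {B : Box} {x : ℚ × ℚ} (h : B.Aligned x) : B.Avoids x := by
  rcases h with h | h
  · exact ⟨Or.inl h.1, Or.inl h.2⟩
  · exact ⟨Or.inr h.1, Or.inr h.2⟩

theorem Below.aligned_of_inside_left {B C : Box} (h : B.Below C) {x : ℚ × ℚ} (hx : B.Inside x) :
    C.Aligned x :=
  Or.inl ⟨hx.1.2.le.trans h.1, hx.2.2.le.trans h.2⟩

theorem Below.aligned_of_inside_right {B C : Box} (h : B.Below C) {x : ℚ × ℚ} (hx : C.Inside x) :
    B.Aligned x :=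
  Or.inr ⟨h.1.trans hx.1.1.le, h.2.trans hx.2.1.le⟩

/-- A pair on one side of a box compares in the same way, in both coordinates, with all pairs in
the box. -/
theorem Aligned.lt_iff {B : Box} {z x : ℚ × ℚ} (hz : B.Aligned z) (hx : B.Inside x) :
    (z.1 < x.1 ↔ z.2 < x.2) ∧ (x.1 < z.1 ↔ x.2 < z.2) := by
  obtain ⟨⟨h1, h2⟩, h3, h4⟩ := hx
  rcases hz with ⟨h5, h6⟩ | ⟨h5, h6⟩
  · exact ⟨iff_of_true (by linarith) (by linarith), iff_of_false (by linarith) (by linarith)⟩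
  · exact ⟨iff_of_false (by linarith) (by linarith), iff_of_true (by linarith) (by linarith)⟩

theorem Aligned.lt_threshold_iff {B : Box} {z : ℚ × ℚ} (hz : B.Aligned z) {α β : ℚ}
    (h₁ : B.l₁ < α) (h₁' : α ≤ B.u₁) (h₂ : B.l₂ < β) (h₂' : β ≤ B.u₂) : z.1 < α ↔ z.2 < β := by
  rcases hz with ⟨h5, h6⟩ | ⟨h5, h6⟩
  · exact iff_of_true (by linarith) (by linarith)
  · exact iff_of_false (by linarith) (by linarith)

end Box

/-- The excess of the paired stream `E` at `(α, β)`: the number of items below `β` in the second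
stream minus the number of items below `α` in the first stream. -/
def excess (E : List (ℚ × ℚ)) (α β : ℚ) : ℤ :=
  (E.countP (fun x => decide (x.2 < β)) : ℤ) - E.countP (fun x => decide (x.1 < α))

theorem excess_append (E F : List (ℚ × ℚ)) (α β : ℚ) :
    excess (E ++ F) α β = excess E α β + excess F α β := by
  simp only [excess, List.countP_append]
  push_cast
  ring

theorem excess_eq_zero {E : List (ℚ × ℚ)} {α β : ℚ} (h : ∀ x ∈ E, (x.1 < α ↔ x.2 < β)) :
    excess E α β = 0 := by
  have : E.countP (fun x => decide (x.2 < β)) = E.countP (fun x => decide (x.1 < α)) :=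
    List.countP_congr fun x hx => by simpa using (h x hx).symm
  simp [excess, this]

theorem excess_congr {E : List (ℚ × ℚ)} {α β α' β' : ℚ}
    (h₁ : ∀ x ∈ E, (x.1 < α ↔ x.1 < α')) (h₂ : ∀ x ∈ E, (x.2 < β ↔ x.2 < β')) :
    excess E α β = excess E α' β' := by
  have e1 : E.countP (fun x => decide (x.2 < β)) = E.countP (fun x => decide (x.2 < β')) :=
    List.countP_congr fun x hx => by simpa using h₂ x hx
  have e2 : E.countP (fun x => decide (x.1 < α)) = E.countP (fun x => decide (x.1 < α')) :=
    List.countP_congr fun x hx => by simpa using h₁ x hx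
  simp [excess, e1, e2]

theorem excess_le_length (E : List (ℚ × ℚ)) (α β : ℚ) : excess E α β ≤ E.length := by
  have := List.countP_le_length (l := E) (p := fun x => decide (x.2 < β))
  unfold excess
  omega

/-- `(α, β)` is a cut, inside the box `B`, of the set `M` of stored pairs: no stored pair separates
the threshold `α` in the first stream from the threshold `β` in the second one. -/
structure IsCut (M : Finset (ℚ × ℚ)) (B : Box) (α β : ℚ) : Prop where
  lt₁ : B.l₁ < α
  le₁ : α ≤ B.u₁
  lt₂ : B.l₂ < β
  le₂ : β ≤ B.u₂
  iff : ∀ z ∈ M, (z.1 < α ↔ z.2 < β)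

theorem IsCut.mono {M : Finset (ℚ × ℚ)} {B C : Box} {α β : ℚ} (h : IsCut M B α β)
    (hBC : B.Sub C) : IsCut M C α β :=
  ⟨hBC.1.1.trans_lt h.lt₁, h.le₁.trans hBC.1.2, hBC.2.1.trans_lt h.lt₂, h.le₂.trans hBC.2.2, h.iff⟩

/-- Among the cuts there is one of largest excess. -/
theorem IsCut.exists_max {M : Finset (ℚ × ℚ)} {B : Box} {α β : ℚ} (h : IsCut M B α β)
    (E : List (ℚ × ℚ)) :
    ∃ α' β', IsCut M B α' β' ∧ ∀ α'' β'', IsCut M B α'' β'' → excess E α'' β'' ≤ excess E α' β' := by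
  obtain ⟨v, ⟨α', β', hc, rfl⟩, hv⟩ := Int.exists_greatest_of_bdd
    (P := fun v => ∃ α' β', IsCut M B α' β' ∧ excess E α' β' = v)
    ⟨E.length, by rintro _ ⟨α', β', -, rfl⟩; exact excess_le_length E α' β'⟩
    ⟨_, α, β, h, rfl⟩
  exact ⟨α', β', hc, fun α'' β'' h'' => hv _ ⟨α'', β'', h'', rfl⟩⟩

/-- The first coordinates of the pairs of `E` in the box `B`. -/
def firsts (E : List (ℚ × ℚ)) (B : Box) : Finset ℚ :=
  (E.toFinset.filter (fun x => B.Inside x)).image Prod.fst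

theorem mem_firsts {E : List (ℚ × ℚ)} {B : Box} {t : ℚ} :
    t ∈ firsts E B ↔ ∃ x ∈ E, B.Inside x ∧ x.1 = t := by
  simp only [firsts, Finset.mem_image, Finset.mem_filter, List.mem_toFinset, and_assoc]

theorem firsts_mono {E F : List (ℚ × ℚ)} {B C : Box} (hE : ∀ x ∈ E, x ∈ F) (hB : B.Sub C) :
    firsts E B ⊆ firsts F C := by
  intro t ht
  obtain ⟨x, hx, hi, rfl⟩ := mem_firsts.1 ht
  exact mem_firsts.2 ⟨x, hE x hx, hB.inside hi, rfl⟩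

/-- If every point of `S` is followed, after at most `h` points of `S`, by a point of `R`, then
`R` is large. -/
theorem card_le_mul_of_gaps_le {S R : Finset ℚ} {h : ℕ}
    (H : ∀ t ∈ S, ∃ θ ∈ R, t ≤ θ ∧ (S.filter (fun x => t ≤ x ∧ x < θ)).card ≤ h) :
    S.card ≤ R.card * (h + 1) := by
  classical
  let C : ℚ → Finset ℚ := fun θ =>
    S.filter (fun t => t ≤ θ ∧ (S.filter (fun x => t ≤ x ∧ x < θ)).card ≤ h)
  have hsub : S ⊆ R.biUnion C := by
    intro t ht
    obtain ⟨θ, hθ, h1, h2⟩ := H t ht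
    exact Finset.mem_biUnion.2 ⟨θ, hθ, Finset.mem_filter.2 ⟨ht, h1, h2⟩⟩
  refine (Finset.card_le_card hsub).trans (Finset.card_biUnion_le_card_mul _ _ _ fun θ _ => ?_)
  rcases (C θ).eq_empty_or_nonempty with he | hne
  · simp [he]
  · -- the points of `C θ` other than `θ` lie between the least one and `θ`
    have hmin := Finset.mem_filter.1 ((C θ).min'_mem hne)
    have : C θ ⊆ insert θ (S.filter (fun x => (C θ).min' hne ≤ x ∧ x < θ)) := by
      intro t ht
      have hle := (C θ).min'_le t ht
      obtain ⟨htS, htθ, -⟩ := Finset.mem_filter.1 ht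
      rcases htθ.eq_or_lt with rfl | hlt
      · exact Finset.mem_insert_self _ _
      · exact Finset.mem_insert_of_mem (Finset.mem_filter.2 ⟨htS, hle, hlt⟩)
    exact (Finset.card_le_card this).trans ((Finset.card_insert_le _ _).trans
      (Nat.succ_le_succ hmin.2.2))

/-- The abstract view of a streaming algorithm on paired streams: `mem H` is the set of pairs that
are stored after the paired stream `H`; only the arriving pair can be added to it. -/
structure IsMemory (mem : List (ℚ × ℚ) → Finset (ℚ × ℚ)) : Prop where
  nil : mem [] = ∅
  append : ∀ H x, mem (H ++ [x]) ⊆ insert x (mem H)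

/-- In both streams, every arriving item compares in the same way with the stored items. -/
def Consistent (mem : List (ℚ × ℚ) → Finset (ℚ × ℚ)) (H : List (ℚ × ℚ)) : Prop :=
  ∀ H' x, H' ++ [x] <+: H → ∀ z ∈ mem H', (z.1 < x.1 ↔ z.2 < x.2) ∧ (x.1 < z.1 ↔ x.2 < z.2)

section Memory

variable {mem : List (ℚ × ℚ) → Finset (ℚ × ℚ)}

theorem consistent_nil : Consistent mem [] := by
  intro H' x h
  simp at h

theorem Consistent.concat {H : List (ℚ × ℚ)} {x : ℚ × ℚ} (h : Consistent mem H)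
    (hx : ∀ z ∈ mem H, (z.1 < x.1 ↔ z.2 < x.2) ∧ (x.1 < z.1 ↔ x.2 < z.2)) :
    Consistent mem (H ++ [x]) := by
  intro H' y hp
  rcases List.prefix_concat_iff.1 hp with h1 | h1
  · obtain ⟨rfl, h2⟩ := List.append_inj' h1 rfl
    obtain rfl : y = x := by simpa using h2
    exact hx
  · exact h H' y h1

theorem Consistent.of_prefix {H H' : List (ℚ × ℚ)} (h : Consistent mem H) (hp : H' <+: H) :
    Consistent mem H' :=
  fun K x hK => h K x (hK.trans hp)

theorem IsMemory.mem_append (hm : IsMemory mem) {H E : List (ℚ × ℚ)} {z : ℚ × ℚ}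
    (hz : z ∈ mem (H ++ E)) : z ∈ mem H ∨ z ∈ E := by
  induction E using List.reverseRecOn with
  | nil => simpa using hz
  | append_singleton E x ih =>
    rw [← List.append_assoc] at hz
    rcases Finset.mem_insert.1 (hm.append _ _ hz) with rfl | h
    · simp
    · rcases ih h with h | h
      · exact Or.inl h
      · exact Or.inr (by simp [h])

/-- In a consistent paired stream, the stored pairs are ordered in the same way by both
coordinates. -/
theorem Consistent.lt_iff (hm : IsMemory mem) {H : List (ℚ × ℚ)} (h : Consistent mem H) :
    ∀ y ∈ mem H, ∀ z ∈ mem H, (y.1 < z.1 ↔ y.2 < z.2) := by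
  induction H using List.reverseRecOn with
  | nil => simp [hm.nil]
  | append_singleton H x ih =>
    have ih := ih (h.of_prefix (List.prefix_append _ _))
    have hx := h H x List.prefix_rfl
    intro y hy z hz
    rcases Finset.mem_insert.1 (hm.append _ _ hy) with rfl | hy' <;>
      rcases Finset.mem_insert.1 (hm.append _ _ hz) with rfl | hz'
    · simp
    · exact (hx z hz').2
    · exact (hx y hy').1
    · exact ih y hy' z hz'

/-- No item of the paired stream `H` has a coordinate in the box `B`, and every stored pair lies on
one side of it: pairs of items can be inserted in `B` consistently. -/
structure Free (mem : List (ℚ × ℚ) → Finset (ℚ × ℚ)) (H : List (ℚ × ℚ)) (B : Box) : Prop where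
  avoids : ∀ x ∈ H, B.Avoids x
  aligned : ∀ z ∈ mem H, B.Aligned z

theorem Free.append (hm : IsMemory mem) {H E : List (ℚ × ℚ)} {B : Box} (h : Free mem H B)
    (hE : ∀ x ∈ E, B.Aligned x) : Free mem (H ++ E) B := by
  refine ⟨fun x hx => ?_, fun z hz => ?_⟩
  · rcases List.mem_append.1 hx with hx | hx
    · exact h.avoids x hx
    · exact (hE x hx).avoids
  · rcases hm.mem_append hz with hz | hz
    · exact h.aligned z hz
    · exact hE z hz

/-- Below any threshold there is some room that avoids a given finite list. -/
theorem exists_room_below (T : List ℚ) {l α : ℚ} (h : l < α) :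
    ∃ l', l ≤ l' ∧ l' < α ∧ ∀ t ∈ T, t ≤ l' ∨ α ≤ t := by
  induction T with
  | nil => exact ⟨l, le_rfl, h, by simp⟩
  | cons t T ih =>
    obtain ⟨l', h1, h2, h3⟩ := ih
    by_cases ht : t < α
    · refine ⟨max l' t, h1.trans (le_max_left _ _), max_lt h2 ht, ?_⟩
      intro s hs
      rcases List.mem_cons.1 hs with rfl | hs
      · exact Or.inl (le_max_right _ _)
      · exact (h3 s hs).imp_left fun h => h.trans (le_max_left _ _)
    · refine ⟨l', h1, h2, ?_⟩
      intro s hs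
      rcases List.mem_cons.1 hs with rfl | hs
      · exact Or.inr (not_lt.1 ht)
      · exact h3 s hs

/-- Just below a cut there is a free box: in the first stream right before `α`, in the second one
right before `β`. -/
theorem IsCut.exists_free {H : List (ℚ × ℚ)} {B : Box} {α β : ℚ}
    (hH : ∀ z ∈ mem H, z ∈ H) (h : IsCut (mem H) B α β) :
    ∃ B' : Box, B'.Sub B ∧ Free mem H B' ∧ B'.u₁ = α ∧ B'.u₂ = β := by
  obtain ⟨l, h1, h2, h3⟩ := exists_room_below (H.map Prod.fst) h.lt₁
  obtain ⟨m, h4, h5, h6⟩ := exists_room_below (H.map Prod.snd) h.lt₂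
  have h3' : ∀ x ∈ H, x.1 ≤ l ∨ α ≤ x.1 := fun x hx => h3 _ (List.mem_map_of_mem hx)
  have h6' : ∀ x ∈ H, x.2 ≤ m ∨ β ≤ x.2 := fun x hx => h6 _ (List.mem_map_of_mem hx)
  refine ⟨⟨l, α, m, β, h2, h5⟩, ⟨⟨h1, h.le₁⟩, h4, h.le₂⟩,
    ⟨fun x hx => ⟨h3' x hx, h6' x hx⟩, fun z hz => ?_⟩, rfl, rfl⟩
  have hi := h.iff z hz
  rcases h3' z (hH z hz) with ha | ha <;> rcases h6' z (hH z hz) with hb | hb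
  · exact Or.inl ⟨ha, hb⟩
  · exact absurd (hi.1 (ha.trans_lt h2)) (not_lt.2 hb)
  · exact absurd (hi.2 (hb.trans_lt h5)) (not_lt.2 ha)
  · exact Or.inr ⟨ha, hb⟩

theorem IsMemory.subset (hm : IsMemory mem) {H : List (ℚ × ℚ)} {z : ℚ × ℚ} (hz : z ∈ mem H) :
    z ∈ H := by
  rcases hm.mem_append (H := []) (E := H) (by simpa using hz) with h | h
  · simp [hm.nil] at h
  · exact h

/-- A free box can be filled with any number of pairs of items that increase in both streams. -/
theorem Free.exists_increasing (hm : IsMemory mem) {H : List (ℚ × ℚ)} {B : Box}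
    (hB : Free mem H B) (hH : Consistent mem H) (L : ℕ) :
    ∃ F : List (ℚ × ℚ), Consistent mem (H ++ F) ∧ (∀ x ∈ F, B.Inside x) ∧ F.length = L ∧
      (∀ x ∈ F, ∀ y ∈ F, (x.1 < y.1 ↔ x.2 < y.2)) ∧ (firsts F B).card = L := by
  induction L with
  | zero => exact ⟨[], by simpa using hH, by simp, rfl, by simp, by simp [firsts]⟩
  | succ L ih =>
    obtain ⟨F, h1, h2, h3, h4, h5⟩ := ih
    obtain ⟨l, a1, a2, a3⟩ := exists_room_below (F.map Prod.fst) B.lt₁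
    obtain ⟨m, b1, b2, b3⟩ := exists_room_below (F.map Prod.snd) B.lt₂
    obtain ⟨a, a4, a5⟩ := exists_between a2
    obtain ⟨b, b4, b5⟩ := exists_between b2
    have hlt₁ : ∀ x ∈ F, x.1 < a := fun x hx => by
      rcases a3 _ (List.mem_map_of_mem hx) with h | h
      · exact h.trans_lt a4
      · exact absurd (h2 x hx).1.2 (not_lt.2 h)
    have hlt₂ : ∀ x ∈ F, x.2 < b := fun x hx => by
      rcases b3 _ (List.mem_map_of_mem hx) with h | h
      · exact h.trans_lt b4
      · exact absurd (h2 x hx).2.2 (not_lt.2 h)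
    have hin : B.Inside (a, b) := ⟨⟨a1.trans_lt a4, a5⟩, b1.trans_lt b4, b5⟩
    have hin' : ∀ x ∈ F ++ [(a, b)], B.Inside x := by
      intro x hx
      rcases List.mem_append.1 hx with hx | hx
      · exact h2 x hx
      · obtain rfl : x = (a, b) := by simpa using hx
        exact hin
    have hfirsts : firsts (F ++ [(a, b)]) B = insert a (firsts F B) := by
      ext t
      simp only [Finset.mem_insert, mem_firsts, List.mem_append, List.mem_singleton]
      constructor
      · rintro ⟨x, hx | rfl, hi, rfl⟩
        · exact Or.inr ⟨x, hx, hi, rfl⟩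
        · exact Or.inl rfl
      · rintro (rfl | ⟨x, hx, hi, rfl⟩)
        · exact ⟨_, Or.inr rfl, hin, rfl⟩
        · exact ⟨x, Or.inl hx, hi, rfl⟩
    refine ⟨F ++ [(a, b)], ?_, hin', by simp [h3], ?_, ?_⟩
    · rw [← List.append_assoc]
      refine h1.concat fun z hz => ?_
      rcases hm.mem_append hz with hz | hz
      · exact (hB.aligned z hz).lt_iff hin
      · exact ⟨iff_of_true (hlt₁ z hz) (hlt₂ z hz),
          iff_of_false (hlt₁ z hz).not_gt (hlt₂ z hz).not_gt⟩
    · intro x hx y hy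
      rcases List.mem_append.1 hx with hx | hx <;> rcases List.mem_append.1 hy with hy | hy
      · exact h4 x hx y hy
      · obtain rfl : y = (a, b) := by simpa using hy
        exact iff_of_true (hlt₁ x hx) (hlt₂ x hx)
      · obtain rfl : x = (a, b) := by simpa using hx
        exact iff_of_false (hlt₁ y hy).not_gt (hlt₂ y hy).not_gt
      · obtain rfl : x = (a, b) := by simpa using hx
        obtain rfl : y = (a, b) := by simpa using hy
        simp
    · rw [hfirsts, Finset.card_insert_of_notMem, h5]
      intro ha
      obtain ⟨x, hx, -, h⟩ := mem_firsts.1 ha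
      exact (hlt₁ x hx).ne h

end Memory

end PairedStream

/-! ### Rounds of play -/

namespace PairedStream

section Memory

variable {mem : List (ℚ × ℚ) → Finset (ℚ × ℚ)}

/-- The boxes `B 0, …, B (R - 1)` of the regions, listed from the highest to the lowest one. -/
def Descending (R : ℕ) (B : ℕ → Box) : Prop :=
  ∀ s t, s < t → t < R → (B t).Below (B s)

theorem Descending.sub {R : ℕ} {B B' : ℕ → Box} (h : Descending R B)
    (hB : ∀ s < R, (B' s).Sub (B s)) : Descending R B' :=
  fun s t hst ht => (hB t ht).below (hB s (hst.trans ht)) (h s t hst ht)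

theorem Descending.aligned {R : ℕ} {B : ℕ → Box} (h : Descending R B) {s t : ℕ} (hs : s < R)
    (ht : t < R) (hst : s ≠ t) {x : ℚ × ℚ} (hx : (B t).Inside x) : (B s).Aligned x := by
  rcases hst.lt_or_gt with hlt | hlt
  · exact (h s t hlt ht).aligned_of_inside_left hx
  · exact (h t s hlt hs).aligned_of_inside_right hx

theorem Descending.eq_of_inside {R : ℕ} {B : ℕ → Box} (h : Descending R B) {s t : ℕ} (hs : s < R)
    (ht : t < R) {x : ℚ × ℚ} (hxs : (B s).Inside x) (hxt : (B t).Inside x) : s = t := by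
  by_contra hst
  exact (h.aligned hs ht hst hxt).avoids.not_inside hxs

/-- The pairs of `p` that are stored after the paired stream `H ++ p`. -/
def storedFrom (mem : List (ℚ × ℚ) → Finset (ℚ × ℚ)) (H p : List (ℚ × ℚ)) : Finset (ℚ × ℚ) :=
  (mem (H ++ p)).filter (· ∈ p)

/-- A round of play `E` after the paired stream `H`, in which the boxes `B s` of the regions `s < R`
receive at least `L * 2 ^ e s` pairs each, and the items below the upper end of a box are no more
than that number for this region and the lower ones together. At the end of the round, no stored
pair has a lower rank in the second stream than in the first one, and each region `s` has a cut
`(α s, β s)` of some excess `h ≥ 0`. At some moment of the round, i.e., after some prefix `p` of it,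
the number of stored pairs from this round was at least the sum of the guarantees `f (e s) h`. -/
structure Round (mem : List (ℚ × ℚ) → Finset (ℚ × ℚ)) (L : ℕ) (f : ℕ → ℝ → ℝ) (R : ℕ) (e : ℕ → ℕ)
    (H : List (ℚ × ℚ)) (B : ℕ → Box) (E p : List (ℚ × ℚ)) (α β : ℕ → ℚ) : Prop where
  consistent : Consistent mem (H ++ E)
  inside : ∀ x ∈ E, ∃ s < R, (B s).Inside x
  le_card_firsts : ∀ s < R, L * 2 ^ e s ≤ (firsts E (B s)).card
  count_le : ∀ s < R,
    E.countP (fun x => decide (x.1 < (B s).u₁)) ≤ ∑ t ∈ Finset.Ico s R, L * 2 ^ e t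
  excess_nonneg : ∀ z ∈ mem (H ++ E), z ∈ E → 0 ≤ excess E z.1 z.2
  cut : ∀ s < R, IsCut (mem (H ++ E)) (B s) (α s) (β s)
  cut_excess_nonneg : ∀ s < R, 0 ≤ excess E (α s) (β s)
  isPrefix : p <+: E
  bound : ∑ s ∈ Finset.range R, f (e s) (excess E (α s) (β s)) ≤ ((storedFrom mem H p).card : ℝ)

/-- From every position with free boxes for `R` regions, a round with exponents `e` and guarantee
`f` can be played. -/
def Forces (mem : List (ℚ × ℚ) → Finset (ℚ × ℚ)) (L : ℕ) (f : ℕ → ℝ → ℝ) (R : ℕ) (e : ℕ → ℕ) :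
    Prop :=
  ∀ (H : List (ℚ × ℚ)) (B : ℕ → Box), Consistent mem H → (∀ s < R, Free mem H (B s)) →
    Descending R B → ∃ E p α β, Round mem L f R e H B E p α β

theorem forces_zero (L : ℕ) (f : ℕ → ℝ → ℝ) (e : ℕ → ℕ) : Forces mem L f 0 e := by
  intro H B hH _ _
  exact ⟨[], [], fun _ => 0, fun _ => 0,
    { consistent := by simpa using hH
      inside := by simp
      le_card_firsts := by simp
      count_le := by simp
      excess_nonneg := by simp
      cut := by simp
      cut_excess_nonneg := by simp
      isPrefix := List.prefix_rfl
      bound := by simp }⟩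

/-- A new lowest region can be added: at the beginning of the round, it receives an increasing
sequence. -/
theorem Forces.add_region (hm : IsMemory mem) {L : ℕ} {f : ℕ → ℝ → ℝ} {R : ℕ} {e : ℕ → ℕ}
    (hf : ∀ h, f 0 h = 0) (he : e R = 0) (hF : Forces mem L f R e) :
    Forces mem L f (R + 1) e := by
  intro H B hH hB hd
  have hR : R < R + 1 := Nat.lt_succ_self R
  obtain ⟨F, hF1, hF2, hF3, hF4, hF5⟩ := (hB R hR).exists_increasing hm hH L
  have hFa : ∀ s < R, ∀ x ∈ F, (B s).Aligned x := fun s hs x hx =>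
    hd.aligned (hs.trans hR) hR hs.ne (hF2 x hx)
  obtain ⟨E, p, α, β, hE⟩ := hF (H ++ F) B hF1
    (fun s hs => (hB s (hs.trans hR)).append hm (hFa s hs))
    (fun s t hst ht => hd s t hst (ht.trans hR))
  have hEa : ∀ x ∈ E, (B R).Aligned x := fun x hx => by
    obtain ⟨s, hs, hi⟩ := hE.inside x hx
    exact hd.aligned hR (hs.trans hR) hs.ne' hi
  have hcons : Consistent mem (H ++ (F ++ E)) := by simpa using hE.consistent
  -- the first sequence does not contribute to the excess at the cuts of the other regions
  have hFex : ∀ s < R, ∀ a b, (B s).l₁ < a → a ≤ (B s).u₁ → (B s).l₂ < b → b ≤ (B s).u₂ →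
      excess F a b = 0 := fun s hs a b h1 h2 h3 h4 =>
    excess_eq_zero fun x hx => (hFa s hs x hx).lt_threshold_iff h1 h2 h3 h4
  have hu : ∀ z, z ∈ mem H ∨ z ∈ F ++ E → (z.1 < (B R).u₁ ↔ z.2 < (B R).u₂) := by
    have hal : ∀ z, (B R).Aligned z → (z.1 < (B R).u₁ ↔ z.2 < (B R).u₂) := fun z hz =>
      hz.lt_threshold_iff (B R).lt₁ le_rfl (B R).lt₂ le_rfl
    rintro z (hz | hz)
    · exact hal z ((hB R hR).aligned z hz)
    · rcases List.mem_append.1 hz with hz | hz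
      · exact iff_of_true (hF2 z hz).1.2 (hF2 z hz).2.2
      · exact hal z (hEa z hz)
  have hcR : IsCut (mem (H ++ (F ++ E))) (B R) (B R).u₁ (B R).u₂ :=
    ⟨(B R).lt₁, le_rfl, (B R).lt₂, le_rfl, fun z hz => hu z (hm.mem_append hz)⟩
  have hex : ∀ s < R, excess (F ++ E) (α s) (β s) = excess E (α s) (β s) := fun s hs => by
    have hc := hE.cut s hs
    rw [excess_append, hFex s hs _ _ hc.lt₁ hc.le₁ hc.lt₂ hc.le₂, zero_add]
  refine ⟨F ++ E, F ++ p, Function.update α R (B R).u₁, Function.update β R (B R).u₂,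
    ⟨hcons, ?_, ?_, ?_, ?_, ?_, ?_, ?_, ?_⟩⟩
  · intro x hx
    rcases List.mem_append.1 hx with hx | hx
    · exact ⟨R, hR, hF2 x hx⟩
    · obtain ⟨s, hs, hi⟩ := hE.inside x hx
      exact ⟨s, hs.trans hR, hi⟩
  · intro s hs
    have hrefl := Box.Sub.refl (B s)
    rcases Nat.lt_succ_iff_lt_or_eq.1 hs with h | rfl
    · exact (hE.le_card_firsts s h).trans
        (Finset.card_le_card (firsts_mono (fun x hx => List.mem_append_right _ hx) hrefl))
    · rw [he, pow_zero, mul_one]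
      calc L = (firsts F (B s)).card := hF5.symm
        _ ≤ _ := Finset.card_le_card (firsts_mono (fun x hx => List.mem_append_left _ hx) hrefl)
  · intro s hs
    have hFL : F.countP (fun x => decide (x.1 < (B s).u₁)) ≤ L :=
      List.countP_le_length.trans hF3.le
    rw [List.countP_append, Finset.sum_Ico_succ_top (Nat.lt_succ_iff.1 hs), he, pow_zero, mul_one,
      add_comm]
    refine add_le_add ?_ hFL
    rcases Nat.lt_succ_iff_lt_or_eq.1 hs with h | rfl
    · exact hE.count_le s h
    · have : E.countP (fun x => decide (x.1 < (B s).u₁)) = 0 := by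
        refine List.countP_eq_zero.2 fun x hx => ?_
        obtain ⟨t, ht, hi⟩ := hE.inside x hx
        simpa using (hd t s ht hs).1.trans hi.1.1.le
      simp [this]
  · intro z hz hzE
    have hz' : z ∈ mem ((H ++ F) ++ E) := by simpa using hz
    rcases List.mem_append.1 hzE with hzF | hzE
    · rw [excess_append, excess_eq_zero fun x hx => hF4 x hx z hzF,
        excess_eq_zero fun x hx => ?_]
      · simp
      · exact ((hEa x hx).lt_iff (hF2 z hzF)).1
    · obtain ⟨s, hs, hi⟩ := hE.inside z hzE
      rw [excess_append, hFex s hs _ _ hi.1.1 hi.1.2.le hi.2.1 hi.2.2.le, zero_add]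
      exact hE.excess_nonneg z hz' hzE
  · intro s hs
    rcases Nat.lt_succ_iff_lt_or_eq.1 hs with h | rfl
    · rw [Function.update_of_ne h.ne, Function.update_of_ne h.ne]
      simpa using hE.cut s h
    · simpa using hcR
  · intro s hs
    rcases Nat.lt_succ_iff_lt_or_eq.1 hs with h | rfl
    · rw [Function.update_of_ne h.ne, Function.update_of_ne h.ne, hex s h]
      exact hE.cut_excess_nonneg s h
    · simpa using (excess_eq_zero fun x hx => hu x (Or.inr hx)).ge
  · exact List.prefix_append_right_inj F |>.2 hE.isPrefix
  · rw [Finset.sum_range_succ, he, hf, add_zero]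
    refine le_trans (le_of_eq (Finset.sum_congr rfl fun s hs => ?_)) (hE.bound.trans ?_)
    · have h := Finset.mem_range.1 hs
      rw [Function.update_of_ne h.ne, Function.update_of_ne h.ne, hex s h]
    · refine Nat.cast_le.2 (Finset.card_le_card fun z hz => ?_)
      simp only [storedFrom, Finset.mem_filter, List.append_assoc, List.mem_append] at hz ⊢
      exact ⟨hz.1, Or.inr hz.2⟩

end Memory

end PairedStream

/-! ### The stored pairs of the first half of a round -/

namespace PairedStream

section Memory

variable {mem : List (ℚ × ℚ) → Finset (ℚ × ℚ)}

theorem card_filter_firsts_le {E : List (ℚ × ℚ)} {B : Box} {a b : ℚ} (hab : a ≤ b) :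
    (((firsts E B).filter (fun x => a ≤ x ∧ x < b)).card : ℤ) ≤
      E.countP (fun x => decide (x.1 < b)) - E.countP (fun x => decide (x.1 < a)) := by
  have h1 : ((firsts E B).filter (fun x => a ≤ x ∧ x < b)).card ≤
      E.countP (fun x => decide (a ≤ x.1 ∧ x.1 < b)) := by
    have : (firsts E B).filter (fun x => a ≤ x ∧ x < b) ⊆
        ((E.filter (fun x => decide (a ≤ x.1 ∧ x.1 < b))).map Prod.fst).toFinset := by
      intro t ht
      obtain ⟨ht1, ht2⟩ := Finset.mem_filter.1 ht
      obtain ⟨x, hx, -, rfl⟩ := mem_firsts.1 ht1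
      simp only [List.mem_toFinset, List.mem_map, List.mem_filter, decide_eq_true_eq]
      exact ⟨x, ⟨hx, ht2⟩, rfl⟩
    refine (Finset.card_le_card this).trans ((List.toFinset_card_le _).trans ?_)
    rw [List.length_map, List.countP_eq_length_filter]
  have h2 : E.countP (fun x => decide (x.1 < b)) =
      E.countP (fun x => decide (a ≤ x.1 ∧ x.1 < b)) + E.countP (fun x => decide (x.1 < a)) := by
    clear h1
    induction E with
    | nil => simp
    | cons x E ih =>
      simp only [List.countP_cons, ih]
      by_cases h : x.1 < a
      · simp [h, h.trans_le hab, not_le.2 h]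
        omega
      · by_cases h' : x.1 < b <;> simp [h, h', not_lt.1 h]
        omega
  rw [h2]
  push_cast
  linarith

/-- If a region with box `Bs` received the pairs of `E₀` first, and then those of `E₁`, the latter
only in a free box `C` inside `Bs`, and if no cut in `Bs` has in the end an excess of more than `h`,
then the stored pairs cut the items of `E₀` into short pieces, and this even at an earlier moment
while `E₁` arrives. For each item `t` of `E₀`, the first pair `y` not below `t` that is stored in
the end is at most `h` items ahead, because `(t, y)` is a cut. If `y` is not from `E₀` but from
`E₁`, then the upper end of `C` takes its place. -/
theorem card_firsts_le (hm : IsMemory mem) {H E₀ E₁ p : List (ℚ × ℚ)} {Bs C : Box} {h : ℕ}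
    (hcons : Consistent mem (H ++ (E₀ ++ E₁))) (hfree : Free mem H Bs)
    (hE₀ : ∀ x ∈ E₀, Bs.Aligned x ∨ Bs.Inside x)
    (hE₁ : ∀ x ∈ E₁, Bs.Aligned x ∨ C.Inside x) (hC : C.Sub Bs)
    (hCE₀ : ∀ x ∈ E₀, C.Avoids x) (hp : p <+: E₁)
    (hnonneg : ∀ z ∈ mem (H ++ (E₀ ++ E₁)), z ∈ E₀ ++ E₁ → 0 ≤ excess (E₀ ++ E₁) z.1 z.2)
    (hmax : ∀ α β, IsCut (mem (H ++ (E₀ ++ E₁))) Bs α β → excess (E₀ ++ E₁) α β ≤ h) :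
    (firsts E₀ Bs).card ≤
      (((mem (H ++ (E₀ ++ p))).filter (fun z => z ∈ E₀ ∧ Bs.Inside z)).card + 2) * (h + 1) := by
  set M := mem (H ++ (E₀ ++ E₁)) with hM
  set E := E₀ ++ E₁ with hE
  set Z := (mem (H ++ (E₀ ++ p))).filter (fun z => z ∈ E₀ ∧ Bs.Inside z) with hZ
  have hEpos : ∀ x ∈ E, Bs.Aligned x ∨ Bs.Inside x := by
    intro x hx
    rcases List.mem_append.1 hx with hx | hx
    · exact hE₀ x hx
    · exact (hE₁ x hx).imp_right hC.inside
  have hMpos : ∀ z ∈ M, Bs.Aligned z ∨ (Bs.Inside z ∧ z ∈ E) := by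
    intro z hz
    rcases hm.mem_append hz with h | h
    · exact Or.inl (hfree.aligned z h)
    · exact (hEpos z h).imp_right fun h' => ⟨h', h⟩
  have hlt := hcons.lt_iff hm
  -- counting in `E` bounds the gaps in `E₀`
  have hgap : ∀ t θ, t ≤ θ →
      (E.countP (fun x => decide (x.1 < θ)) : ℤ) - E.countP (fun x => decide (x.1 < t)) ≤ h →
      ((firsts E₀ Bs).filter (fun x => t ≤ x ∧ x < θ)).card ≤ h := by
    intro t θ hle hc
    have h1 := card_filter_firsts_le (E := E) (B := Bs) hle
    have h2 : ((firsts E₀ Bs).filter (fun x => t ≤ x ∧ x < θ)).card ≤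
        ((firsts E Bs).filter (fun x => t ≤ x ∧ x < θ)).card :=
      Finset.card_le_card (Finset.filter_subset_filter _
        (firsts_mono (fun x hx => List.mem_append_left _ hx) (Box.Sub.refl Bs)))
    omega
  let R : Finset ℚ := insert C.u₁ (insert Bs.u₁ (Z.image Prod.fst))
  have hR : R.card ≤ Z.card + 2 :=
    (Finset.card_insert_le _ _).trans (Nat.succ_le_succ ((Finset.card_insert_le _ _).trans
      (Nat.succ_le_succ Finset.card_image_le)))
  refine (card_le_mul_of_gaps_le (R := R) (h := h) fun t ht => ?_).trans
    (Nat.mul_le_mul_right _ hR)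
  obtain ⟨x, hx, hxi, rfl⟩ := mem_firsts.1 ht
  -- the stored pairs not below `x`, with the upper end of the box as a sentinel
  let S : Finset (ℚ × ℚ) := insert (Bs.u₁, Bs.u₂) (M.filter (fun z => x.1 ≤ z.1))
  obtain ⟨y, hyS, hymin⟩ := S.exists_min_image Prod.snd ⟨_, Finset.mem_insert_self _ _⟩
  have hyu : y.2 ≤ Bs.u₂ := hymin _ (Finset.mem_insert_self _ _)
  have hSpos : ∀ z ∈ S, Bs.l₂ < z.2 := by
    intro z hz
    rcases Finset.mem_insert.1 hz with rfl | hz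
    · exact Bs.lt₂
    · obtain ⟨hz, hxz⟩ := Finset.mem_filter.1 hz
      rcases hMpos z hz with (h1 | h1) | h1
      · exact absurd hxi.1.1 (not_lt.2 (hxz.trans h1.1))
      · exact Bs.lt₂.trans_le h1.2
      · exact h1.1.2.1
  have hcut : IsCut M Bs x.1 y.2 := by
    refine ⟨hxi.1.1, hxi.1.2.le, hSpos y hyS, hyu, fun z hz => ⟨fun hzx => ?_, fun hzy => ?_⟩⟩
    · rcases Finset.mem_insert.1 hyS with rfl | hy
      · rcases hMpos z hz with (h1 | h1) | h1
        · exact h1.2.trans_lt Bs.lt₂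
        · exact absurd (hzx.trans hxi.1.2) (not_lt.2 h1.1)
        · exact h1.1.2.2
      · obtain ⟨hy, hxy⟩ := Finset.mem_filter.1 hy
        exact (hlt z hz y hy).1 (hzx.trans_le hxy)
    · by_contra hzx
      exact absurd hzy (not_lt.2
        (hymin z (Finset.mem_insert_of_mem (Finset.mem_filter.2 ⟨hz, not_lt.1 hzx⟩))))
  have hexc := hmax _ _ hcut
  unfold excess at hexc
  rcases hyu.eq_or_lt with hyeq | hylt
  · -- no stored pair ahead of `x` in the box
    refine ⟨Bs.u₁, by simp [R], hxi.1.2.le, hgap _ _ hxi.1.2.le ?_⟩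
    have h0 : excess E Bs.u₁ Bs.u₂ = 0 := excess_eq_zero fun z hz => by
      rcases hEpos z hz with h1 | h1
      · exact h1.lt_threshold_iff Bs.lt₁ le_rfl Bs.lt₂ le_rfl
      · exact iff_of_true h1.1.2 h1.2.2
    unfold excess at h0
    rw [hyeq] at hexc
    linarith
  · rcases Finset.mem_insert.1 hyS with rfl | hy
    · exact absurd hylt (lt_irrefl _)
    obtain ⟨hy, hxy⟩ := Finset.mem_filter.1 hy
    have hyE : Bs.Inside y ∧ y ∈ E := by
      rcases hMpos y hy with (h1 | h1) | h1
      · exact absurd (hSpos y hyS) (not_lt.2 h1.2)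
      · exact absurd hylt (not_lt.2 h1.2)
      · exact h1
    have hy0 := hnonneg y hy hyE.2
    unfold excess at hy0
    by_cases hy1 : y ∈ E₁
    · have hyC : C.Inside y := (hE₁ y hy1).resolve_left fun h1 => h1.avoids.not_inside hyE.1
      have hxC : x.1 ≤ C.l₁ := (hCE₀ x hx).1.resolve_right fun h1 =>
        absurd hyC.1.2 (not_lt.2 (h1.trans hxy))
      refine ⟨C.u₁, by simp [R], hxC.trans C.lt₁.le, ?_⟩
      -- `E₀` has no items in the first interval of `C`
      have : (firsts E₀ Bs).filter (fun s => x.1 ≤ s ∧ s < C.u₁) ⊆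
          (firsts E₀ Bs).filter (fun s => x.1 ≤ s ∧ s < y.1) := by
        intro s hs
        obtain ⟨hs, hs1, hs2⟩ := Finset.mem_filter.1 hs
        obtain ⟨w, hw, -, rfl⟩ := mem_firsts.1 hs
        refine Finset.mem_filter.2 ⟨hs, hs1, ?_⟩
        exact ((hCE₀ w hw).1.resolve_right (not_le.2 hs2)).trans_lt hyC.1.1
      exact (Finset.card_le_card this).trans (hgap _ _ hxy (by linarith))
    · have hyE₀ : y ∈ E₀ := (List.mem_append.1 hyE.2).resolve_right hy1
      have hyZ : y ∈ Z := by
        refine Finset.mem_filter.2 ⟨?_, hyE₀, hyE.1⟩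
        obtain ⟨q, rfl⟩ := hp
        have : y ∈ mem ((H ++ (E₀ ++ p)) ++ q) := by simpa [hM] using hy
        exact (hm.mem_append this).resolve_right fun hq => hy1 (List.mem_append_right _ hq)
      refine ⟨y.1, ?_, hxy, hgap _ _ hxy (by linarith)⟩
      simp only [R, Finset.mem_insert]
      exact Or.inr (Or.inr (Finset.mem_image_of_mem _ hyZ))

end Memory

end PairedStream

/-! ### Doubling a round -/

namespace PairedStream

section Memory

variable {mem : List (ℚ × ℚ) → Finset (ℚ × ℚ)}

/-- A round can be doubled: after a first round, every box is narrowed down to a free box at the cut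
of that round, and a second round is played there. The excesses of the two rounds add up. The
better one of the two moments of the rounds is chosen. At the moment of the second round, pairs
from the first round are stored in addition, at least `q` of them per region. As the maximum of
the two numbers of stored pairs is at least their mean, the guarantee `f` has to satisfy `hf`. -/
theorem Forces.double (hm : IsMemory mem) {L : ℕ} {f : ℕ → ℝ → ℝ} {R : ℕ} {e : ℕ → ℕ}
    (hf : ∀ (e q h : ℕ) (h₀ h₁ : ℝ), h₀ + h₁ ≤ h → L * 2 ^ e ≤ (q + 2) * (h + 1) →
      2 * f (e + 1) h ≤ f e h₀ + f e h₁ + q)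
    (hF : Forces mem L f R e) : Forces mem L f R (fun s => e s + 1) := by
  intro H B hH hB hd
  obtain ⟨E₀, p₀, α₀, β₀, h0⟩ := hF H B hH hB hd
  -- the narrowed boxes
  have hex : ∀ s, ∃ C : Box, s < R → C.Sub (B s) ∧ Free mem (H ++ E₀) C ∧
      C.u₁ = α₀ s ∧ C.u₂ = β₀ s := by
    intro s
    by_cases hs : s < R
    · obtain ⟨C, hC⟩ := (h0.cut s hs).exists_free (fun z hz => hm.subset hz)
      exact ⟨C, fun _ => hC⟩
    · exact ⟨B s, fun h => absurd h hs⟩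
  choose C hC using hex
  have hsub : ∀ s < R, (C s).Sub (B s) := fun s hs => (hC s hs).1
  have hfree : ∀ s < R, Free mem (H ++ E₀) (C s) := fun s hs => (hC s hs).2.1
  have hdC := hd.sub hsub
  obtain ⟨E₁, p₁, α₁, β₁, h1⟩ := hF (H ++ E₀) C h0.consistent hfree hdC
  have hCE₀ : ∀ s < R, ∀ x ∈ E₀, (C s).Avoids x := fun s hs x hx =>
    (hfree s hs).avoids x (List.mem_append_right _ hx)
  have hassoc : H ++ (E₀ ++ E₁) = (H ++ E₀) ++ E₁ := (List.append_assoc _ _ _).symm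
  have hcons : Consistent mem (H ++ (E₀ ++ E₁)) := hassoc ▸ h1.consistent
  have hpos₀ : ∀ s < R, ∀ x ∈ E₀, (B s).Aligned x ∨ (B s).Inside x := by
    intro s hs x hx
    obtain ⟨t, ht, hi⟩ := h0.inside x hx
    rcases eq_or_ne s t with rfl | hst
    · exact Or.inr hi
    · exact Or.inl (hd.aligned hs ht hst hi)
  have hpos₁ : ∀ s < R, ∀ x ∈ E₁, (B s).Aligned x ∨ (C s).Inside x := by
    intro s hs x hx
    obtain ⟨t, ht, hi⟩ := h1.inside x hx
    rcases eq_or_ne s t with rfl | hst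
    · exact Or.inr hi
    · exact Or.inl (hd.aligned hs ht hst ((hsub t ht).inside hi))
  -- inside the narrowed boxes, the excess of the first round is that of its cut
  have hE₀ : ∀ s < R, ∀ a b, (C s).l₁ < a → a ≤ (C s).u₁ → (C s).l₂ < b → b ≤ (C s).u₂ →
      excess E₀ a b = excess E₀ (α₀ s) (β₀ s) := by
    intro s hs a b ha ha' hb hb'
    obtain ⟨-, -, hα, hβ⟩ := hC s hs
    rw [← hα, ← hβ]
    refine excess_congr (fun x hx => ?_) (fun x hx => ?_)
    · rcases (hCE₀ s hs x hx).1 with h | h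
      · exact iff_of_true (h.trans_lt ha) (h.trans_lt (C s).lt₁)
      · exact iff_of_false (not_lt.2 (ha'.trans h)) (not_lt.2 h)
    · rcases (hCE₀ s hs x hx).2 with h | h
      · exact iff_of_true (h.trans_lt hb) (h.trans_lt (C s).lt₂)
      · exact iff_of_false (not_lt.2 (hb'.trans h)) (not_lt.2 h)
  have hsum : ∀ s < R, excess (E₀ ++ E₁) (α₁ s) (β₁ s) =
      excess E₀ (α₀ s) (β₀ s) + excess E₁ (α₁ s) (β₁ s) := by
    intro s hs
    have hc := h1.cut s hs
    rw [excess_append, hE₀ s hs _ _ hc.lt₁ hc.le₁ hc.lt₂ hc.le₂]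
  -- a cut of largest excess in each region
  have hbest : ∀ s, ∃ α β, s < R → IsCut (mem (H ++ (E₀ ++ E₁))) (B s) α β ∧
      (∀ α' β', IsCut (mem (H ++ (E₀ ++ E₁))) (B s) α' β' →
        excess (E₀ ++ E₁) α' β' ≤ excess (E₀ ++ E₁) α β) := by
    intro s
    by_cases hs : s < R
    · obtain ⟨α, β, h, h'⟩ := IsCut.exists_max (hassoc ▸ (h1.cut s hs).mono (hsub s hs)) (E₀ ++ E₁)
      exact ⟨α, β, fun _ => ⟨h, h'⟩⟩
    · exact ⟨0, 0, fun h => absurd h hs⟩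
  choose α β hαβ using hbest
  have hge : ∀ s < R, excess E₀ (α₀ s) (β₀ s) + excess E₁ (α₁ s) (β₁ s) ≤
      excess (E₀ ++ E₁) (α s) (β s) := by
    intro s hs
    rw [← hsum s hs]
    exact (hαβ s hs).2 _ _ (hassoc ▸ (h1.cut s hs).mono (hsub s hs))
  have hnn : ∀ s < R, 0 ≤ excess (E₀ ++ E₁) (α s) (β s) := fun s hs =>
    (add_nonneg (h0.cut_excess_nonneg s hs) (h1.cut_excess_nonneg s hs)).trans (hge s hs)
  have hnonneg : ∀ z ∈ mem (H ++ (E₀ ++ E₁)), z ∈ E₀ ++ E₁ → 0 ≤ excess (E₀ ++ E₁) z.1 z.2 := by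
    intro z hz hzE
    rw [hassoc] at hz
    rw [excess_append]
    by_cases hz1 : z ∈ E₁
    · obtain ⟨s, hs, hi⟩ := h1.inside z hz1
      rw [hE₀ s hs _ _ hi.1.1 hi.1.2.le hi.2.1 hi.2.2.le]
      exact add_nonneg (h0.cut_excess_nonneg s hs) (h1.excess_nonneg z hz hz1)
    · have hz0 : z ∈ mem (H ++ E₀) := (hm.mem_append hz).resolve_right hz1
      rw [excess_eq_zero (E := E₁) fun x hx => ?_, add_zero]
      · exact h0.excess_nonneg z hz0 ((List.mem_append.1 hzE).resolve_right hz1)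
      · obtain ⟨s, hs, hi⟩ := h1.inside x hx
        exact (((hfree s hs).aligned z hz0).lt_iff hi).2
  -- the stored pairs of the first round at the moment `p₁` of the second one
  let Z : ℕ → Finset (ℚ × ℚ) := fun s =>
    (mem (H ++ (E₀ ++ p₁))).filter (fun z => z ∈ E₀ ∧ (B s).Inside z)
  have hZ : ∀ s < R, 2 * f (e s + 1) (excess (E₀ ++ E₁) (α s) (β s)) ≤
      f (e s) (excess E₀ (α₀ s) (β₀ s)) + f (e s) (excess E₁ (α₁ s) (β₁ s)) + (Z s).card := by
    intro s hs
    obtain ⟨h, hh⟩ := Int.eq_ofNat_of_zero_le (hnn s hs)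
    rw [hh, Int.cast_natCast]
    refine hf _ _ _ _ _ ?_ ?_
    · have := hge s hs
      rw [hh] at this
      exact_mod_cast this
    · refine (h0.le_card_firsts s hs).trans (card_firsts_le hm hcons (hB s hs) (hpos₀ s hs)
        (hpos₁ s hs) (hsub s hs) (hCE₀ s hs) h1.isPrefix hnonneg fun a b hab => ?_)
      rw [← hh]
      exact (hαβ s hs).2 a b hab
  have hcard : (storedFrom mem (H ++ E₀) p₁).card + ∑ s ∈ Finset.range R, (Z s).card ≤
      (storedFrom mem H (E₀ ++ p₁)).card := by
    have hdisj : ((Finset.range R : Finset ℕ) : Set ℕ).PairwiseDisjoint Z := by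
      intro s hs t ht hst
      refine Finset.disjoint_left.2 fun z hz hz' => hst ?_
      exact hd.eq_of_inside (Finset.mem_range.1 hs) (Finset.mem_range.1 ht)
        (Finset.mem_filter.1 hz).2.2 (Finset.mem_filter.1 hz').2.2
    rw [← Finset.card_biUnion hdisj, ← Finset.card_union_of_disjoint]
    · refine Finset.card_le_card fun z hz => ?_
      rcases Finset.mem_union.1 hz with hz | hz
      · simp only [storedFrom, Finset.mem_filter, List.append_assoc, List.mem_append] at hz ⊢
        exact ⟨hz.1, Or.inr hz.2⟩
      · obtain ⟨s, -, hz⟩ := Finset.mem_biUnion.1 hz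
        simp only [Z, storedFrom, Finset.mem_filter, List.mem_append] at hz ⊢
        exact ⟨hz.1, Or.inl hz.2.1⟩
    · refine Finset.disjoint_left.2 fun z hz hz' => ?_
      obtain ⟨s, -, hz'⟩ := Finset.mem_biUnion.1 hz'
      have hz1 : z ∈ E₁ := h1.isPrefix.subset (Finset.mem_filter.1 hz).2
      obtain ⟨t, ht, hi⟩ := h1.inside z hz1
      exact (hCE₀ t ht z (Finset.mem_filter.1 hz').2.1).not_inside hi
  have hmain : ∃ p, p <+: E₀ ++ E₁ ∧
      ∑ s ∈ Finset.range R, f (e s + 1) (excess (E₀ ++ E₁) (α s) (β s)) ≤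
        ((storedFrom mem H p).card : ℝ) := by
    have hs2 := Finset.sum_le_sum fun s hs => hZ s (Finset.mem_range.1 hs)
    rw [Finset.sum_add_distrib, Finset.sum_add_distrib, ← Finset.mul_sum] at hs2
    have b0 := h0.bound
    have b1 := h1.bound
    have hc : ((storedFrom mem (H ++ E₀) p₁).card : ℝ) + ∑ s ∈ Finset.range R, ((Z s).card : ℝ) ≤
        (storedFrom mem H (E₀ ++ p₁)).card := by exact_mod_cast hcard
    rcases le_total ((storedFrom mem H (E₀ ++ p₁)).card : ℝ) ((storedFrom mem H p₀).card : ℝ)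
      with hle | hle
    · exact ⟨p₀, h0.isPrefix.trans (List.prefix_append _ _), by linarith⟩
    · exact ⟨E₀ ++ p₁, (List.prefix_append_right_inj _).2 h1.isPrefix, by linarith⟩
  obtain ⟨p, hp, hbound⟩ := hmain
  refine ⟨E₀ ++ E₁, p, α, β, ⟨hcons, ?_, ?_, ?_, hnonneg, fun s hs => (hαβ s hs).1, hnn, hp,
    hbound⟩⟩
  · intro x hx
    rcases List.mem_append.1 hx with hx | hx
    · exact h0.inside x hx
    · obtain ⟨s, hs, hi⟩ := h1.inside x hx
      exact ⟨s, hs, (hsub s hs).inside hi⟩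
  · intro s hs
    have hdisj : Disjoint (firsts E₀ (B s)) (firsts E₁ (C s)) := by
      refine Finset.disjoint_left.2 fun t ht ht' => ?_
      obtain ⟨x, hx, -, rfl⟩ := mem_firsts.1 ht
      obtain ⟨y, -, hy, hxy⟩ := mem_firsts.1 ht'
      rcases (hCE₀ s hs x hx).1 with h | h
      · exact absurd hy.1.1 (not_lt.2 (hxy.le.trans h))
      · exact absurd hy.1.2 (not_lt.2 (h.trans hxy.ge))
    calc L * 2 ^ (e s + 1) = L * 2 ^ e s + L * 2 ^ e s := by ring
      _ ≤ (firsts E₀ (B s)).card + (firsts E₁ (C s)).card :=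
        add_le_add (h0.le_card_firsts s hs) (h1.le_card_firsts s hs)
      _ = (firsts E₀ (B s) ∪ firsts E₁ (C s)).card := (Finset.card_union_of_disjoint hdisj).symm
      _ ≤ _ := Finset.card_le_card (Finset.union_subset
        (firsts_mono (fun x hx => List.mem_append_left _ hx) (Box.Sub.refl _))
        (firsts_mono (fun x hx => List.mem_append_right _ hx) (hsub s hs)))
  · intro s hs
    have hle : E₁.countP (fun x => decide (x.1 < (B s).u₁)) ≤
        E₁.countP (fun x => decide (x.1 < (C s).u₁)) := by
      refine List.countP_mono_left fun x hx hlt => ?_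
      simp only [decide_eq_true_eq] at hlt ⊢
      rcases hpos₁ s hs x hx with (h | h) | h
      · exact h.1.trans_lt ((hsub s hs).1.1.trans_lt (C s).lt₁)
      · exact absurd hlt (not_lt.2 h.1)
      · exact h.1.2
    calc (E₀ ++ E₁).countP (fun x => decide (x.1 < (B s).u₁))
        ≤ ∑ t ∈ Finset.Ico s R, L * 2 ^ e t + ∑ t ∈ Finset.Ico s R, L * 2 ^ e t := by
          rw [List.countP_append]
          exact add_le_add (h0.count_le s hs) (hle.trans (h1.count_le s hs))
      _ = ∑ t ∈ Finset.Ico s R, L * 2 ^ (e t + 1) := by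
          rw [← Finset.sum_add_distrib]
          exact Finset.sum_congr rfl fun t _ => by ring

end Memory

end PairedStream

/-! ### Summaries on paired streams -/

namespace ComparisonSummary

variable {G : Type*}

/-- One step of the summary `D` on items of any type `V`, compared by `c`. -/
def stepBy (D : ComparisonSummary G) {V : Type*} (c : V → V → Ordering) (M : List V × G) (a : V) :
    List V × G :=
  let r := D.update M.1.length (fun j => c a (M.1.get j)) M.2
  (r.1.map (fun o => o.elim a M.1.get), r.2)

theorem stepBy_eq (D : ComparisonSummary G) {V : Type*} (c : V → V → Ordering) (I : List V) (g : G)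
    (a : V) {n : ℕ} (hn : n = I.length) :
    D.stepBy c (I, g) a =
      ((D.update n (fun j => c a (I.get (j.cast hn))) g).1.map
        (fun o => o.elim a fun j => I.get (j.cast hn)),
        (D.update n (fun j => c a (I.get (j.cast hn))) g).2) := by
  subst hn
  rfl

/-- A summary sees its items only through comparisons. -/
theorem stepBy_map (D : ComparisonSummary G) {V W : Type*} (c : V → V → Ordering)
    (c' : W → W → Ordering) (f : V → W) (I : List V) (g : G) (a : V)
    (h : ∀ v ∈ I, c' (f a) (f v) = c a v) :
    D.stepBy c' (I.map f, g) (f a) = ((D.stepBy c (I, g) a).1.map f, (D.stepBy c (I, g) a).2) := by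
  have hlen : I.length = (I.map f).length := (List.length_map f).symm
  rw [stepBy_eq D c' (I.map f) g (f a) hlen]
  have hcmp : (fun j : Fin I.length => c' (f a) ((I.map f).get (j.cast hlen))) =
      fun j => c a (I.get j) := by
    funext j
    rw [← h _ (List.get_mem I j)]
    simp
  rw [hcmp]
  simp only [stepBy, List.map_map, Prod.mk.injEq, and_true]
  refine List.map_congr_left fun o _ => ?_
  cases o <;> simp

theorem mem_stepBy (D : ComparisonSummary G) {V : Type*} {c : V → V → Ordering} {M : List V × G}
    {a v : V} (hv : v ∈ (D.stepBy c M a).1) : v = a ∨ v ∈ M.1 := by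
  simp only [stepBy, List.mem_map] at hv
  obtain ⟨o, -, rfl⟩ := hv
  cases o with
  | none => exact Or.inl rfl
  | some j => exact Or.inr (List.get_mem _ _)

/-- The memory state after a paired stream, where the summary is driven by the comparisons of the
first coordinates. -/
def pairRun (D : ComparisonSummary G) (H : List (ℚ × ℚ)) : List (ℚ × ℚ) × G :=
  H.foldl (D.stepBy fun x y => cmp x.1 y.1) ([], D.init)

/-- The pairs stored after a paired stream. -/
def stored (D : ComparisonSummary G) (H : List (ℚ × ℚ)) : Finset (ℚ × ℚ) :=
  (D.pairRun H).1.toFinset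

theorem pairRun_concat (D : ComparisonSummary G) (H : List (ℚ × ℚ)) (x : ℚ × ℚ) :
    D.pairRun (H ++ [x]) = D.stepBy (fun x y => cmp x.1 y.1) (D.pairRun H) x := by
  simp [pairRun]

theorem isMemory_stored (D : ComparisonSummary G) : PairedStream.IsMemory D.stored := by
  refine ⟨by simp [stored, pairRun], fun H x z hz => ?_⟩
  simp only [stored, pairRun_concat, List.mem_toFinset, Finset.mem_insert] at hz ⊢
  exact D.mem_stepBy hz

variable {U : Type*} [LinearOrder U]

theorem run_concat (D : ComparisonSummary G) (σ : List U) (a : U) :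
    D.run (σ ++ [a]) = D.stepBy cmp (D.run σ) a := by
  simp [run, List.foldl_append, step, stepBy]

theorem run_map (D : ComparisonSummary G) (f : ℚ × ℚ → U) {H : List (ℚ × ℚ)}
    (h : ∀ H' x, H' ++ [x] <+: H → ∀ z ∈ D.stored H', cmp (f x) (f z) = cmp x.1 z.1) :
    D.run (H.map f) = ((D.pairRun H).1.map f, (D.pairRun H).2) := by
  induction H using List.reverseRecOn with
  | nil => simp [run, pairRun]
  | append_singleton H x ih =>
    rw [List.map_append, List.map_singleton, run_concat, pairRun_concat,
      ih fun H' y hp => h H' y (hp.trans (List.prefix_append _ _))]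
    exact D.stepBy_map _ _ f _ _ x fun v hv => h H x List.prefix_rfl v (by simpa [stored] using hv)

theorem run_map_fst (D : ComparisonSummary G) (ι : ℚ ↪o U) (H : List (ℚ × ℚ)) :
    D.run (H.map fun x => ι x.1) = ((D.pairRun H).1.map fun x => ι x.1, (D.pairRun H).2) :=
  D.run_map _ fun _ _ _ _ _ => ι.strictMono.cmp_map_eq _ _

/-- On the two streams of a consistent paired stream, the summary works in the same way. -/
theorem run_map_snd (D : ComparisonSummary G) (ι : ℚ ↪o U) {H : List (ℚ × ℚ)}
    (h : PairedStream.Consistent D.stored H) :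
    D.run (H.map fun x => ι x.2) = ((D.pairRun H).1.map fun x => ι x.2, (D.pairRun H).2) := by
  refine D.run_map _ fun H' x hp z hz => ?_
  obtain ⟨h1, h2⟩ := h H' x hp z hz
  rw [ι.strictMono.cmp_map_eq]
  rcases lt_trichotomy x.1 z.1 with hlt | heq | hgt
  · rw [(cmp_eq_lt_iff _ _).2 hlt, (cmp_eq_lt_iff _ _).2 (h2.1 hlt)]
  · rw [(cmp_eq_eq_iff _ _).2 heq, cmp_eq_eq_iff]
    exact le_antisymm (not_lt.1 fun h => heq.not_gt (h1.2 h)) (not_lt.1 fun h => heq.not_lt (h2.2 h))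
  · rw [(cmp_eq_gt_iff _ _).2 hgt, (cmp_eq_gt_iff _ _).2 (h1.1 hgt)]

theorem length_run_take_le (D : ComparisonSummary G) {σ τ : List U} (h : τ <+: σ) :
    (D.run τ).1.length ≤ D.itemsStored σ := by
  obtain ⟨ρ, rfl⟩ := h
  have := Finset.le_sup (f := fun t => (D.run ((τ ++ ρ).take t)).1.length)
    (Finset.mem_range.2 (show τ.length < (τ ++ ρ).length + 1 by simp))
  simpa [itemsStored] using this

end ComparisonSummary

namespace PairedStream

open ComparisonSummary

variable {G : Type*} {U : Type*} [LinearOrder U]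

theorem countP_le_of_isKthSmallest {ι : ℚ ↪o U} {f : ℚ × ℚ → ℚ} {H : List (ℚ × ℚ)} {k : ℕ} {z : ℚ}
    (h : IsKthSmallest (H.map fun x => ι (f x)) k (ι z)) :
    (∀ θ, z < θ → k ≤ H.countP (fun x => decide (f x < θ))) ∧
      (∀ θ, θ ≤ z → H.countP (fun x => decide (f x < θ)) < k) := by
  obtain ⟨h1, h2⟩ := h
  rw [List.countP_map] at h1 h2
  constructor
  · intro θ hθ
    refine h2.trans (List.countP_mono_left fun x _ hx => ?_)
    simp only [Function.comp_apply, ι.le_iff_le, decide_eq_true_eq] at hx ⊢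
    exact hx.trans_lt hθ
  · intro θ hθ
    refine (List.countP_mono_left fun x _ hx => ?_).trans_lt h1
    simp only [Function.comp_apply, ι.lt_iff_lt, decide_eq_true_eq] at hx ⊢
    exact hx.trans_le hθ

/-- The query for rank `r`, answered with the same stored pair in both streams. -/
theorem exists_stored_near {D : ComparisonSummary G} {ε : ℝ} (hD : IsBiasedQuantileSummary U D ε)
    (ι : ℚ ↪o U) {H : List (ℚ × ℚ)} (hH : Consistent D.stored H) {r : ℕ} (hr : 1 ≤ r)
    (hrH : r ≤ H.length) :
    ∃ z ∈ D.stored H,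
      (∃ k : ℕ, IsKthSmallest (H.map fun x => ι x.1) k (ι z.1) ∧ |(k : ℝ) - r| ≤ ε * r) ∧
      (∃ k : ℕ, IsKthSmallest (H.map fun x => ι x.2) k (ι z.2) ∧ |(k : ℝ) - r| ≤ ε * r) := by
  have hN : (0 : ℝ) < H.length := by exact_mod_cast (hr.trans hrH : 0 < H.length)
  have hφ : (r : ℝ) / H.length * H.length = r := div_mul_cancel₀ _ hN.ne'
  have key : ∀ f : ℚ × ℚ → U, ∃ x : U, D.query (H.map f) (r / H.length) = some x ∧
      ∃ k : ℕ, IsKthSmallest (H.map f) k x ∧ |(k : ℝ) - r| ≤ ε * r := by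
    intro f
    have := hD (H.map f) (r / H.length) (by positivity)
      ((div_le_one hN).2 (by exact_mod_cast hrH))
      (by rw [List.length_map, hφ, Nat.floor_natCast]; exact hr)
    rwa [List.length_map, mul_assoc, hφ, Nat.floor_natCast] at this
  obtain ⟨x, hx, k, hk⟩ := key fun x => ι x.1
  obtain ⟨y, hy, l, hl⟩ := key fun x => ι x.2
  rw [query, D.run_map_fst ι, List.getElem?_map, List.length_map, Option.map_eq_some_iff] at hx
  rw [query, D.run_map_snd ι hH, List.getElem?_map, List.length_map, Option.map_eq_some_iff] at hy
  obtain ⟨z, hz, rfl⟩ := hx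
  obtain ⟨z', hz', rfl⟩ := hy
  obtain rfl : z = z' := Option.some_injective _ (hz.symm.trans hz')
  exact ⟨z, List.mem_toFinset.2 (List.mem_of_getElem? hz), ⟨k, hk⟩, l, hl⟩

/-- A summary that answers all queries cannot have a cut of large excess: at a rank between the two
thresholds, every stored pair is too far away in one of the two streams. -/
theorem excess_le_of_isBiasedQuantileSummary {D : ComparisonSummary G} {ε : ℝ} (hε : 0 < ε)
    (hε1 : ε < 1) (hD : IsBiasedQuantileSummary U D ε) (ι : ℚ ↪o U) {H : List (ℚ × ℚ)}
    (hH : Consistent D.stored H) {α β : ℚ} (hcut : ∀ z ∈ D.stored H, (z.1 < α ↔ z.2 < β)) :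
    (excess H α β : ℝ) ≤ 2 * ε / (1 - ε) * H.countP (fun x => decide (x.1 < α)) + ε := by
  set a := H.countP (fun x => decide (x.1 < α)) with ha
  set b := H.countP (fun x => decide (x.2 < β)) with hb
  have h1ε : 0 < 1 - ε := by linarith
  have hexc : (excess H α β : ℝ) = b - a := by simp [excess, ha, hb]
  set r := ⌊(a : ℝ) / (1 - ε)⌋₊ + 1 with hr
  have ha0 : (0 : ℝ) ≤ a / (1 - ε) := by positivity
  have hr1 : (a : ℝ) / (1 - ε) < r := by
    rw [hr]; push_cast; exact Nat.lt_floor_add_one _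
  have hr2 : (r : ℝ) ≤ a / (1 - ε) + 1 := by
    rw [hr]; push_cast; linarith [Nat.floor_le ha0]
  have hsplit : (a : ℝ) / (1 - ε) = a + ε / (1 - ε) * a := by field_simp; ring
  have hpos : (0 : ℝ) ≤ ε / (1 - ε) * a := by positivity
  rw [hexc, show 2 * ε / (1 - ε) * (a : ℝ) = 2 * (ε / (1 - ε) * a) by ring]
  rcases le_or_gt r H.length with hrH | hrH
  · obtain ⟨z, hz, ⟨k, hk, hk'⟩, l, hl, hl'⟩ :=
      exists_stored_near hD ι hH (r := r) (by omega) hrH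
    have hk := (countP_le_of_isKthSmallest (f := Prod.fst) hk).1 α
    have hl := (countP_le_of_isKthSmallest (f := Prod.snd) hl).2 β
    rw [abs_le] at hk' hl'
    by_cases hzα : z.1 < α
    · have hka : (k : ℝ) ≤ a := by exact_mod_cast hk hzα
      rw [div_lt_iff₀ h1ε] at hr1
      linarith
    · have hlb : (b : ℝ) + 1 ≤ l := by
        exact_mod_cast hl (not_lt.1 fun h => hzα ((hcut z hz).2 h))
      have h3 : (b : ℝ) + 1 ≤ (1 + ε) * (a / (1 - ε) + 1) := by nlinarith
      have h4 : ε * (a / (1 - ε)) = ε / (1 - ε) * a := by ring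
      nlinarith
  · have hbH : b ≤ H.length := List.countP_le_length
    have : (b : ℝ) + 1 ≤ r := by exact_mod_cast (Nat.succ_le_of_lt (hbH.trans_lt hrH))
    linarith

end PairedStream

/-! ### The guarantee and the choice of the regions -/

namespace PairedStream

theorem Forces.congr {mem : List (ℚ × ℚ) → Finset (ℚ × ℚ)} {L : ℕ} {f : ℕ → ℝ → ℝ} {R : ℕ}
    {e e' : ℕ → ℕ} (he : ∀ s < R, e s = e' s) (h : Forces mem L f R e) : Forces mem L f R e' := by
  intro H B hH hB hd
  obtain ⟨E, p, α, β, hE⟩ := h H B hH hB hd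
  refine ⟨E, p, α, β, ⟨hE.consistent, hE.inside, fun s hs => he s hs ▸ hE.le_card_firsts s hs,
    fun s hs => (hE.count_le s hs).trans_eq (Finset.sum_congr rfl fun t ht => ?_),
    hE.excess_nonneg, hE.cut, hE.cut_excess_nonneg, hE.isPrefix,
    le_of_eq_of_le (Finset.sum_congr rfl fun t ht => ?_) hE.bound⟩⟩
  · rw [he t (Finset.mem_Ico.1 ht).2]
  · rw [he t (Finset.mem_range.1 ht)]

/-- The number of stored pairs that a region with excess `h` guarantees after `e` doublings. It is
linear in `h`, so that it can be added up over the two halves of a round. -/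
noncomputable def guarantee (ε : ℝ) (L : ℕ) (e : ℕ) (h : ℝ) : ℝ :=
  e * (1 / (6 * ε) - 1 - 1 / (72 * ε ^ 2 * L) - h / (36 * ε ^ 2 * L * 2 ^ e))

/-- The hyperbola `q + 2 = L * 2 ^ e / (h + 1)` lies above its tangent line at
`h + 1 = 6 * ε * L * 2 ^ e`. This is the excess that a summary is allowed in a region with
`L * 2 ^ (e + 1)` items. -/
theorem guarantee_double {ε : ℝ} (hε : 0 < ε) {L : ℕ} (hL : 0 < L) (e q h : ℕ) (h₀ h₁ : ℝ)
    (hh : h₀ + h₁ ≤ h) (hq : L * 2 ^ e ≤ (q + 2) * (h + 1)) :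
    2 * guarantee ε L (e + 1) h ≤ guarantee ε L e h₀ + guarantee ε L e h₁ + q := by
  have hL' : (0 : ℝ) < L := by exact_mod_cast hL
  set P : ℝ := 2 ^ e with hP
  have hP1 : 1 ≤ P := one_le_pow₀ (by norm_num)
  have hP0 : 0 < P := by linarith
  have hq' : (L : ℝ) * P ≤ (q + 2) * (h + 1) := by rw [hP]; exact_mod_cast hq
  set y : ℝ := (h : ℝ) + 1 with hy
  have hy0 : 0 < y := by positivity
  -- the tangent line
  have htan : 1 / (3 * ε) - y / (36 * ε ^ 2 * L * P) ≤ q + 2 := by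
    refine le_of_mul_le_mul_right ?_ hy0
    refine le_trans ?_ hq'
    have : (L : ℝ) * P - (1 / (3 * ε) - y / (36 * ε ^ 2 * L * P)) * y =
        L * P * (1 - y / (6 * ε * L * P)) ^ 2 := by
      field_simp
      ring
    have h2 : 0 ≤ L * P * (1 - y / (6 * ε * L * P)) ^ 2 := by positivity
    linarith
  set η : ℝ := 1 / (36 * ε ^ 2 * L) with hη
  have hη0 : 0 < η := by positivity
  have e1 : y / (36 * ε ^ 2 * L * P) = η * h / P + η / P := by
    rw [hη, hy]; field_simp
  have e2 : η / P ≤ η := div_le_self hη0.le hP1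
  have hg : ∀ x : ℝ, guarantee ε L e x = e * (1 / (6 * ε) - 1 - η / 2 - η * x / P) := by
    intro x
    rw [guarantee, ← hP, hη]
    congr 1
    field_simp
    ring
  have hg' : 2 * guarantee ε L (e + 1) h =
      2 * ((e : ℝ) + 1) * (1 / (6 * ε) - 1 - η / 2) - ((e : ℝ) + 1) * (η * h / P) := by
    rw [guarantee, pow_succ 2 e, ← hP, hη]
    push_cast
    field_simp
    ring
  have e3 : (e : ℝ) * (η * (h₀ + h₁) / P) ≤ e * (η * h / P) := by gcongr
  have e4 : 1 / (3 * ε) = 2 * (1 / (6 * ε)) := by field_simp; norm_num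
  have e5 : η * (h₀ + h₁) / P = η * h₀ / P + η * h₁ / P := by ring
  rw [hg, hg, hg']
  rw [e5] at e3
  rw [e1, e4] at htan
  nlinarith

theorem guarantee_ge {ε : ℝ} (hε : 0 < ε) (hε1 : ε < 1 / 16) {L : ℕ} (hL : 16 ≤ ε * L) (e : ℕ)
    {h : ℝ} (hh : h ≤ 3 * ε * L * 2 ^ e) : e * (1 / (64 * ε)) ≤ guarantee ε L e h := by
  have hL0 : (0 : ℝ) < L := by
    by_contra h0
    nlinarith
  unfold guarantee
  have h1 : h / (36 * ε ^ 2 * L * 2 ^ e) ≤ 1 / 12 * (1 / ε) := by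
    rw [div_le_iff₀ (by positivity)]
    refine hh.trans_eq ?_
    field_simp
    norm_num
  have h2 : 1 / (72 * ε ^ 2 * L) ≤ 1 / 1152 * (1 / ε) := by
    rw [div_le_iff₀ (by positivity)]
    have : 1 / 1152 * (1 / ε) * (72 * ε ^ 2 * L) = ε * L / 16 := by field_simp; norm_num
    rw [this]
    linarith
  have h3 : (1 : ℝ) ≤ 1 / 16 * (1 / ε) := by
    rw [mul_one_div, le_div_iff₀ hε]
    linarith
  have h4 : 1 / (6 * ε) = 1 / 6 * (1 / ε) := by field_simp
  have h5 : 1 / (64 * ε) = 1 / 64 * (1 / ε) := by field_simp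
  have h6 : 0 < 1 / ε := by positivity
  refine mul_le_mul_of_nonneg_left ?_ (Nat.cast_nonneg e)
  rw [h4, h5]
  linarith

/-- With two doublings after the addition of each region, region `s` receives `L * 4 ^ (k - s)`
pairs, so that the regions below it increase the ranks of its items only by a third of that. -/
theorem forces_geometric {mem : List (ℚ × ℚ) → Finset (ℚ × ℚ)} (hm : IsMemory mem) {ε : ℝ}
    (hε : 0 < ε) {L : ℕ} (hL : 0 < L) (k : ℕ) :
    Forces mem L (guarantee ε L) k (fun s => 2 * (k - s)) := by
  induction k with
  | zero => exact forces_zero _ _ _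
  | succ k ih =>
    have h1 := ih.add_region hm (by simp [guarantee]) (by simp)
    have h2 := (h1.double hm (guarantee_double hε hL)).double hm (guarantee_double hε hL)
    exact h2.congr fun s hs => by omega

theorem sum_pow_Ico_le {s k : ℕ} (h : s ≤ k) :
    3 * ∑ t ∈ Finset.Ico s k, 2 ^ (2 * (k - t)) + 4 = 4 * 2 ^ (2 * (k - s)) := by
  induction k, h using Nat.le_induction with
  | base => simp
  | succ k hk ih =>
    have : ∀ t ∈ Finset.Ico s k, 2 ^ (2 * (k + 1 - t)) = 4 * 2 ^ (2 * (k - t)) := fun t ht => by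
      rw [Nat.succ_sub (Finset.mem_Ico.1 ht).2.le, Nat.mul_succ, pow_add]; ring
    have h1 : 2 ^ (2 * (k + 1 - s)) = 4 * 2 ^ (2 * (k - s)) := by
      rw [Nat.succ_sub hk, Nat.mul_succ, pow_add]; ring
    rw [Finset.sum_Ico_succ_top hk, Finset.sum_congr rfl this, ← Finset.mul_sum, h1, ← ih,
      Nat.add_sub_cancel_left]
    ring

end PairedStream

/-! ### Lower bounds on the number of stored items -/

namespace ComparisonSummary

open PairedStream

variable {G : Type*} {U : Type*} [LinearOrder U]

theorem le_itemsStored_of_regions {D : ComparisonSummary G} {ε : ℝ} (hε : 0 < ε)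
    (hε1 : ε < 1 / 16) (hD : IsBiasedQuantileSummary U D ε) (ι : ℚ ↪o U) {k N : ℕ} (hk : 1 ≤ k)
    (hN : 23 * 4 ^ k ≤ ε * N) :
    ∃ σ : List U, σ.length = N ∧ (k : ℝ) ^ 2 / (64 * ε) ≤ D.itemsStored σ := by
  set L := ⌈16 / ε⌉₊ with hLdef
  have hL1 : 16 / ε ≤ L := Nat.le_ceil _
  have hL2 : (L : ℝ) < 16 / ε + 1 := Nat.ceil_lt_add_one (by positivity)
  have hεL : 16 ≤ ε * L := by rwa [div_le_iff₀' hε] at hL1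
  have hεL2 : ε * L ≤ 17 := by
    have := mul_lt_mul_of_pos_left hL2 hε
    rw [mul_add, mul_div_cancel₀ _ hε.ne'] at this
    linarith
  have hL0 : 0 < L := Nat.ceil_pos.2 (by positivity)
  have hL0' : (0 : ℝ) < L := by exact_mod_cast hL0
  let B : ℕ → Box := fun s =>
    ⟨-(s : ℚ) - 1, -(s : ℚ), -(s : ℚ) - 1, -(s : ℚ), by linarith, by linarith⟩
  have hd : Descending k B := by
    intro s t hst _
    have : (s : ℚ) + 1 ≤ t := by exact_mod_cast hst
    constructor <;> simp only [B] <;> linarith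
  obtain ⟨E, p, α, β, hE⟩ := forces_geometric D.isMemory_stored hε hL0 k [] B consistent_nil
    (fun s _ => ⟨by simp, by simp [D.isMemory_stored.nil]⟩) hd
  have hcons : Consistent D.stored E := by simpa using hE.consistent
  have hcount : ∀ s < k, (E.countP (fun x => decide (x.1 < (B s).u₁)) : ℝ) ≤
      4 / 3 * (L * 2 ^ (2 * (k - s))) := by
    intro s hs
    have h1 := hE.count_le s hs
    rw [← Finset.mul_sum] at h1
    have h2 : (3 : ℝ) * ∑ t ∈ Finset.Ico s k, 2 ^ (2 * (k - t)) + 4 = 4 * 2 ^ (2 * (k - s)) := by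
      exact_mod_cast sum_pow_Ico_le hs.le
    have h3 : (E.countP (fun x => decide (x.1 < (B s).u₁)) : ℝ) ≤
        L * ∑ t ∈ Finset.Ico s k, 2 ^ (2 * (k - t)) := by exact_mod_cast h1
    nlinarith
  have hlen : E.length ≤ N := by
    have h1 : E.countP (fun x => decide (x.1 < (B 0).u₁)) = E.length := by
      refine List.countP_eq_length.2 fun x hx => ?_
      obtain ⟨s, hs, hi⟩ := hE.inside x hx
      have : (B s).u₁ ≤ (B 0).u₁ := by simp [B]
      simpa using hi.1.2.trans_le this
    have h2 := hcount 0 hk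
    rw [h1, Nat.sub_zero, pow_mul] at h2
    have h3 : ε * E.length ≤ ε * N := by
      refine (mul_le_mul_of_nonneg_left h2 hε.le).trans (le_trans ?_ hN)
      have : (0 : ℝ) < 4 ^ k := by positivity
      norm_num
      nlinarith
    exact_mod_cast le_of_mul_le_mul_left h3 hε
  have hex : ∀ s < k, (excess E (α s) (β s) : ℝ) ≤ 3 * ε * L * 2 ^ (2 * (k - s)) := by
    intro s hs
    have hc := hE.cut s hs
    have h1 := excess_le_of_isBiasedQuantileSummary hε (by linarith) hD ι hcons
      (α := α s) (β := β s) (by simpa using hc.iff)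
    have h2 : (E.countP (fun x => decide (x.1 < α s)) : ℝ) ≤
        E.countP (fun x => decide (x.1 < (B s).u₁)) :=
      Nat.cast_le.2 (List.countP_mono_left fun x _ hx => by
        simp only [decide_eq_true_eq] at hx ⊢
        exact hx.trans_le hc.le₁)
    have h3 := h2.trans (hcount s hs)
    set A : ℝ := L * 2 ^ (2 * (k - s)) with hA
    have hA1 : 16 ≤ ε * A := by
      have : (1 : ℝ) ≤ 2 ^ (2 * (k - s)) := one_le_pow₀ (by norm_num)
      rw [hA, ← mul_assoc]
      nlinarith
    have h4 : 2 * ε / (1 - ε) ≤ 32 / 15 * ε := by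
      rw [div_le_iff₀ (by linarith)]
      nlinarith
    have h5 : 2 * ε / (1 - ε) * (E.countP (fun x => decide (x.1 < α s)) : ℝ) ≤
        32 / 15 * ε * (4 / 3 * A) := mul_le_mul h4 h3 (Nat.cast_nonneg _) (by positivity)
    calc (excess E (α s) (β s) : ℝ) ≤ 32 / 15 * ε * (4 / 3 * A) + ε := by linarith
      _ ≤ 3 * (ε * A) := by linarith
      _ = _ := by rw [hA]; ring
  have hsum : (k : ℝ) ^ 2 / (64 * ε) ≤ (storedFrom D.stored [] p).card := by
    refine le_trans ?_ hE.bound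
    have h1 : ∑ s ∈ Finset.range k, ((2 * (k - s) : ℕ) : ℝ) * (1 / (64 * ε)) ≤
        ∑ s ∈ Finset.range k, guarantee ε L (2 * (k - s)) (excess E (α s) (β s)) :=
      Finset.sum_le_sum fun s hs =>
        guarantee_ge hε hε1 hεL _ (hex s (Finset.mem_range.1 hs))
    refine le_trans ?_ h1
    rw [← Finset.sum_mul, div_eq_mul_one_div]
    refine mul_le_mul_of_nonneg_right ?_ (by positivity)
    have h2 : k ^ 2 ≤ ∑ s ∈ Finset.range k, 2 * (k - s) := by
      clear * -
      induction k with
      | zero => simp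
      | succ k ih =>
        rw [Finset.sum_range_succ']
        simp only [Nat.succ_sub_succ_eq_sub, Nat.sub_zero]
        nlinarith
    exact_mod_cast h2
  -- the bound is attained after the prefix `p`, so that `E` may be extended arbitrarily
  refine ⟨(E.map fun x => ι x.1) ++ List.replicate (N - E.length) (ι 0), by simp [hlen],
    hsum.trans (Nat.cast_le.2 ?_)⟩
  refine le_trans ?_ (D.length_run_take_le (τ := p.map fun x => ι x.1)
    ((hE.isPrefix.map _).trans (List.prefix_append _ _)))
  rw [D.run_map_fst, List.length_map]
  refine (Finset.card_le_card (Finset.filter_subset _ _)).trans ?_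
  simpa [stored] using List.toFinset_card_le _

/-- A biased quantile summary has to store the lowest items themselves. -/
theorem le_itemsStored_of_lowest {D : ComparisonSummary G} {ε : ℝ} (hε : 0 < ε)
    (hD : IsBiasedQuantileSummary U D ε) (ι : ℚ ↪o U) {N : ℕ} (hN : 1 ≤ ε * N) :
    ∃ σ : List U, σ.length = N ∧ 1 / ε - 1 ≤ D.itemsStored σ := by
  set σ : List U := (List.range N).map fun i : ℕ => ι (i : ℚ) with hσ
  have hlen : σ.length = N := by simp [hσ]
  have hnodup : σ.Nodup := List.nodup_range.map fun i j h => by simpa using h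
  have hN0 : (0 : ℝ) < N := by
    by_contra h
    nlinarith
  refine ⟨σ, hlen, ?_⟩
  have hle : ∀ x : U, σ.countP (fun y => decide (y ≤ x)) ≤
      σ.countP (fun y => decide (y < x)) + 1 := by
    intro x
    refine le_trans ?_ (Nat.add_le_add_left (List.nodup_iff_count_le_one.1 hnodup x) _)
    clear * -
    induction σ with
    | nil => simp
    | cons y σ ih =>
      simp only [List.countP_cons, List.count_cons]
      rcases lt_trichotomy y x with h | rfl | h
      · simp [h, h.le, h.ne]; omega
      · simp; omega
      · simp [h.not_ge, h.not_gt, h.ne']; omega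
  -- the query of rank `r < 1 / ε` must be answered exactly
  have key : ∀ r ∈ Finset.Ico 1 ⌈1 / ε⌉₊, ∃ x ∈ (D.run σ).1, IsKthSmallest σ r x := by
    intro r hr
    obtain ⟨hr1, hr2⟩ := Finset.mem_Ico.1 hr
    have hr3 : ε * r < 1 := by
      have := Nat.lt_ceil.1 hr2
      rwa [lt_div_iff₀' hε] at this
    have hφ : (r : ℝ) / N * N = r := div_mul_cancel₀ _ hN0.ne'
    have hrN : (r : ℝ) ≤ N := le_of_mul_le_mul_left (hr3.le.trans hN) hε
    have h := hD σ (r / N) (by positivity) ((div_le_one hN0).2 hrN)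
      (by rw [hlen, hφ, Nat.floor_natCast]; exact hr1)
    rw [hlen, mul_assoc, hφ, Nat.floor_natCast] at h
    obtain ⟨x, hx, l, hl, hlr⟩ := h
    have h1 : |((l : ℤ) - r : ℤ)| < 1 := by exact_mod_cast hlr.trans_lt hr3
    obtain rfl : l = r := by
      have := Int.abs_lt_one_iff.1 h1
      omega
    exact ⟨x, List.mem_of_getElem? hx, hl⟩
  have : Nonempty U := ⟨ι 0⟩
  choose! x hx hx' using key
  have hinj : Set.InjOn x (↑(Finset.Ico 1 ⌈1 / ε⌉₊) : Set ℕ) := by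
    intro r hr s hs hrs
    have h1 := hx' r hr
    have h2 := hx' s hs
    rw [← hrs] at h2
    have h3 := hle (x r)
    unfold IsKthSmallest at h1 h2
    omega
  have hcard : ⌈1 / ε⌉₊ - 1 ≤ (D.run σ).1.length := by
    rw [← Nat.card_Ico, ← Finset.card_image_of_injOn hinj]
    refine (Finset.card_le_card fun y hy => ?_).trans (List.toFinset_card_le _)
    obtain ⟨r, hr, rfl⟩ := Finset.mem_image.1 hy
    exact List.mem_toFinset.2 (hx r hr)
  have h1 := hcard.trans (D.length_run_take_le List.prefix_rfl)
  have h2 : (⌈1 / ε⌉₊ : ℝ) ≤ D.itemsStored σ + 1 := by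
    exact_mod_cast Nat.sub_le_iff_le_add.1 h1
  linarith [Nat.le_ceil (1 / ε)]

end ComparisonSummary

theorem mainTheorem5 :
    ∃ c : ℝ, 0 < c ∧
      ∀ (U : Type*) [LinearOrder U] [DenselyOrdered U] [Nontrivial U]
        (ε : ℝ), 0 < ε → ε < 1 / 16 →
      ∀ (G : Type*) (D : ComparisonSummary G), IsBiasedQuantileSummary U D ε →
      ∀ N : ℕ, 1 ≤ ε * (N : ℝ) →
        ∃ σ : List U, σ.length = N ∧
          c * (1 / ε * Real.log (ε * (N : ℝ)) ^ 2) ≤ (D.itemsStored σ : ℝ) := by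
  refine ⟨1 / 3200, by norm_num, fun U _ _ _ ε hε hε1 G D hD N hN => ?_⟩
  obtain ⟨ι⟩ := Order.embedding_from_countable_to_dense ℚ U
  have hlog0 : 0 ≤ Real.log (ε * N) := Real.log_nonneg hN
  have hexp : (2.7 : ℝ) < Real.exp 1 := lt_trans (by norm_num) Real.exp_one_gt_d9
  have hlog92 : Real.log 92 ≤ 5 := by
    rw [Real.log_le_iff_le_exp (by norm_num), show (5 : ℝ) = (5 : ℕ) * 1 by norm_num,
      Real.exp_nat_mul]
    refine le_trans ?_ (pow_le_pow_left₀ (by norm_num) hexp.le 5)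
    norm_num
  have hinv : 0 < 1 / ε := by positivity
  rcases lt_or_ge (ε * N) 92 with hsmall | hlarge
  · obtain ⟨σ, hσ, h⟩ := ComparisonSummary.le_itemsStored_of_lowest hε hD ι hN
    refine ⟨σ, hσ, le_trans ?_ h⟩
    have h1 : Real.log (ε * N) ≤ 5 :=
      (Real.log_le_log (by linarith) hsmall.le).trans hlog92
    have h2 : Real.log (ε * N) ^ 2 ≤ 25 := by nlinarith
    have h3 : (16 : ℝ) ≤ 1 / ε := by
      rw [le_div_iff₀ hε]
      linarith
    nlinarith [mul_le_mul_of_nonneg_left h2 hinv.le]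
  · -- `k` is largest with `23 * 4 ^ k ≤ ε * N`
    have hfl : 4 ≤ ⌊ε * N / 23⌋₊ := Nat.le_floor (by norm_num; linarith)
    set k := Nat.log 4 ⌊ε * N / 23⌋₊ with hk
    have hk1 : 1 ≤ k := Nat.log_pos (by norm_num) hfl
    have hk2 : (23 : ℝ) * 4 ^ k ≤ ε * N := by
      have h1 : 4 ^ k ≤ ⌊ε * N / 23⌋₊ := Nat.pow_log_le_self 4 (by omega)
      have h2 : ((4 ^ k : ℕ) : ℝ) ≤ ε * N / 23 := (Nat.le_floor_iff (by positivity)).1 h1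
      push_cast at h2
      linarith
    have hk3 : ε * N ≤ 92 * 4 ^ k := by
      have h1 : ⌊ε * N / 23⌋₊ < 4 ^ (k + 1) := Nat.lt_pow_succ_log_self (by norm_num) _
      have h2 : ε * N / 23 < ((4 ^ (k + 1) : ℕ) : ℝ) := (Nat.floor_lt (by positivity)).1 h1
      push_cast at h2
      rw [pow_succ] at h2
      linarith
    obtain ⟨σ, hσ, h⟩ := ComparisonSummary.le_itemsStored_of_regions hε hε1 hD ι hk1 hk2
    refine ⟨σ, hσ, le_trans ?_ h⟩
    have hk1' : (1 : ℝ) ≤ k := by exact_mod_cast hk1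
    have hlog4 : Real.log 4 ≤ 2 := by
      rw [Real.log_le_iff_le_exp (by norm_num), show (2 : ℝ) = (2 : ℕ) * 1 by norm_num,
        Real.exp_nat_mul]
      refine le_trans ?_ (pow_le_pow_left₀ (by norm_num) hexp.le 2)
      norm_num
    have h1 : Real.log (ε * N) ≤ 7 * k := by
      refine (Real.log_le_log (by linarith) hk3).trans ?_
      rw [Real.log_mul (by norm_num) (by positivity), Real.log_pow]
      nlinarith
    have h2 : Real.log (ε * N) ^ 2 ≤ 49 * (k : ℝ) ^ 2 := by nlinarith
    have h3 : (k : ℝ) ^ 2 / (64 * ε) = 1 / 64 * (1 / ε * (k : ℝ) ^ 2) := by field_simp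
    rw [h3]
    nlinarith [mul_le_mul_of_nonneg_left h2 hinv.le, mul_nonneg hinv.le (sq_nonneg (k : ℝ))]
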